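/- Let $R$ be a commutative local ring with infinite residue field, equipped with an involution $r \mapsto \bar r$ (a ring automorphism with $\bar{\bar r} = r$, possibly the identity). Let $\epsilon \in R$ satisfy $\epsilon\bar\epsilon = 1$, and let $\Lambda$ be a form parameter, i.e. an additive subgroup of $R$ with $\{r-\epsilon\bar r : r\in R\} \subseteq \Lambda \subseteq \{r \in R : \epsilon \bar r=-r\}$ and $\bar r\Lambda r\subseteq\Lambda$ for all $r \in R$. On $R^{2n}$ consider $h(x,y)=\sum_{i=1}^n(\bar x_{2i-1}y_{2i}+\epsilon\bar x_{2i}y_{2i-1})$ and $q(x)=\sum_{i=1}^n\bar x_{2i-1}x_{2i} \in R/\Lambda$. For a set $S$ let $\mathcal O(S)$ be the set of nonempty finite sequences of distinct elements of $S$, ordered by passing to subsequences; write $|v|$ for the length of $v$. For $X\subseteq\mathcal O(S)$ closed under passing to nonempty subsequences and for $w\in X$, put $X_w=\{v\in X : (v,w)\in X\}$, where $(v,w)$ is the concatenation. Let $C_*(X)$ be the complex with $C_k(X)$, $k\ge 0$, the free $\mathbb Z$-module on the elements $(v_0,\dots,v_k)$ of $X$ of length $k+1$, with $C_{-1}(X)=\mathbb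 Z$ and $C_k(X)=0$ for $k\le-2$, with $\partial_k=\sum_{i=0}^k(-1)^id_i$ for $k \ge 1$, where $d_i$ deletes $v_i$, and with $\partial_0(\sum n_iv_i)=\sum n_i$. For $d\in\mathbb Z$, $X$ is called $d$-acyclic if $H_k(C_*(X))=0$ for all $0\le k\le d$ (no condition if $d<0$). Let $\mathcal U(R^m)$ be the set of nonempty sequences $(v_1,\dots,v_k)$ that form a basis of a free direct summand of $R^m$, and let $\mathcal{IU}(R^{2n})\subseteq\mathcal U(R^{2n})$ be the set of those that form a basis of an isotropic direct summand (one on which $q$ and $h$ vanish). Put $\underline{\mathcal U}(R^m)=\{(\langle v_1\rangle,\dots,\langle v_k\rangle) : (v_1,\dots,v_k)\in\mathcal U(R^m)\}$ and $\underline{\mathcal{IU}}(R^{2n})=\{(\langle v_1\rangle,\dots,\langle v_k\rangle) : (v_1,\dots,v_k)\in\mathcal{IU}(R^{2n})\}$. For $n\le m$ view $R^n=\langle e_1,\dots,e_n\rangle\subseteq R^m$, and let $\mathbb P^{n-1}$ be the set of lines $\langle v\rangle$ spanned by unimodular vectors $v \in R^n$ (i.e. $v$ is a basis of a free direct summand of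 $R^n$). **Theorem.** Let $n\le m$ be natural numbers. Then the poset $\mathcal O(\mathbb P^{n-1})\cap\underline{\mathcal U}(R^m)$ is $(n-2)$-acyclic; the poset $\mathcal O(\mathbb P^{n-1})\cap\underline{\mathcal U}(R^m)_w$ is $(n-|w|-2)$-acyclic for every $w\in\underline{\mathcal U}(R^m)$; and the poset $\underline{\mathcal{IU}}(R^{2n})$ is $(n-2)$-acyclic. -/

import Mathlib

/-! ### Posets of frames and their homology -/

/-- `O(S)`: the nonempty finite sequences of distinct elements of `S`. It is ordered by
refinement: `u ≤ v` iff `u` is a subsequence of `v`, i.e. `List.Sublist u v`. -/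
def OrdSeq (S : Type*) : Set (List S) := {v | v ≠ [] ∧ v.Nodup}

/-- A subposet of `O(S)` that satisfies the chain condition: with `v` it contains every
`u ≤ v` in `O(S)`. -/
structure FramePoset (S : Type*) where
  /-- the underlying set of sequences -/
  carrier : Set (List S)
  subset_ordSeq : carrier ⊆ OrdSeq S
  chain : ∀ ⦃u v : List S⦄, v ∈ carrier → u.Sublist v → u ≠ [] → u ∈ carrier

namespace FramePoset

variable {S : Type*}

/-- `O(T) ∩ X` for a subset `T` of `S`. -/
def restrict (X : FramePoset S) (T : Set S) : FramePoset S where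
  carrier := {v | v ∈ X.carrier ∧ ∀ x ∈ v, x ∈ T}
  subset_ordSeq := fun _ hv => X.subset_ordSeq hv.1
  chain := fun _ _ hv huv hu => ⟨X.chain hv.1 huv hu, fun x hx => hv.2 x (huv.subset hx)⟩

/-- `X_w`: the sequences `v` in `X` such that the concatenation `(v, w)` is in `X`. -/
def link (X : FramePoset S) (w : List S) : FramePoset S where
  carrier := {v | v ∈ X.carrier ∧ v ++ w ∈ X.carrier}
  subset_ordSeq := fun _ hv => X.subset_ordSeq hv.1
  chain := fun _ _ hv huv hu =>
    ⟨X.chain hv.1 huv hu, X.chain hv.2 (huv.append (List.Sublist.refl w)) (by simp [hu])⟩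

/-- The `k`-simplices of `X`: the members of `X` of length `k + 1`. -/
abbrev Simplex (X : FramePoset S) (k : ℕ) : Type _ :=
  {v : List S // v ∈ X.carrier ∧ v.length = k + 1}

/-- `C_k(X)` for `k ≥ 0`: the free `ℤ`-module on the `k`-simplices. -/
abbrev Chain (X : FramePoset S) (k : ℕ) : Type _ := X.Simplex k →₀ ℤ

/-- `d_i`: delete the `i`-th entry (counted from `0`). -/
def face (X : FramePoset S) {k : ℕ} (v : X.Simplex (k + 1)) (i : Fin (k + 2)) : X.Simplex k :=
  have hl : (v.1.eraseIdx i).length = k + 1 := by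
    have h1 := v.2.2
    have h2 := i.2
    rw [List.length_eraseIdx]
    split_ifs <;> omega
  ⟨v.1.eraseIdx i, X.chain v.2.1 (List.eraseIdx_sublist _ _)
    (by intro h; rw [h] at hl; simp at hl), hl⟩

/-- The differential `C_{k+1}(X) → C_k(X)`, `∑ i, (-1)^i d_i`. -/
noncomputable def boundary (X : FramePoset S) (k : ℕ) : X.Chain (k + 1) →ₗ[ℤ] X.Chain k :=
  Finsupp.linearCombination ℤ
    (fun v => ∑ i : Fin (k + 2), (-1 : ℤ) ^ (i : ℕ) • Finsupp.single (X.face v i) (1 : ℤ))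

/-- The differential `C_0(X) → C_{-1}(X) = ℤ`, `∑ n_i v_i ↦ ∑ n_i`. -/
noncomputable def augmentation (X : FramePoset S) : X.Chain 0 →ₗ[ℤ] ℤ :=
  Finsupp.linearCombination ℤ (fun _ => (1 : ℤ))

/-- The `k`-cycles of the augmented complex `C_*(X)`, `k ≥ 0`. -/
noncomputable def cycles (X : FramePoset S) : (k : ℕ) → Submodule ℤ (X.Chain k)
  | 0 => LinearMap.ker X.augmentation
  | k + 1 => LinearMap.ker (X.boundary k)

/-- The `k`-boundaries of the augmented complex `C_*(X)`, `k ≥ 0`. -/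
noncomputable def boundaries (X : FramePoset S) (k : ℕ) : Submodule ℤ (X.Chain k) :=
  LinearMap.range (X.boundary k)

/-- Alternating sum of the sequences obtained by deleting one entry, without length bookkeeping. -/
noncomputable def delta : List S → (List S →₀ ℤ)
  | [] => 0
  | a :: l => Finsupp.single l 1 - Finsupp.mapDomain (List.cons a) (delta l)

/-- The linear extension of `delta`. -/
noncomputable def deltaLin : (List S →₀ ℤ) →ₗ[ℤ] (List S →₀ ℤ) :=
  Finsupp.linearCombination ℤ delta

theorem deltaLin_cons (a : S) (x : List S →₀ ℤ) :
    deltaLin (Finsupp.mapDomain (List.cons a) x) =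
      x - Finsupp.mapDomain (List.cons a) (deltaLin x) := by
  induction x using Finsupp.induction_linear with
  | zero => simp
  | add x y hx hy =>
    rw [Finsupp.mapDomain_add, map_add, hx, hy, map_add, Finsupp.mapDomain_add]; abel
  | single l r =>
    simp only [deltaLin, Finsupp.mapDomain_single, Finsupp.linearCombination_single, delta,
      smul_sub, Finsupp.mapDomain_smul]
    simp

theorem deltaLin_delta (l : List S) : deltaLin (delta l) = 0 := by
  induction l with
  | nil => simp [delta]
  | cons a l ih =>
    rw [delta, map_sub, deltaLin_cons, ih]
    simp [deltaLin]

theorem delta_eq (l : List S) :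
    delta l = ∑ i : Fin l.length, (-1 : ℤ) ^ (i : ℕ) • Finsupp.single (l.eraseIdx i) (1 : ℤ) := by
  induction l with
  | nil => simp [delta]
  | cons a l ih =>
    rw [delta, ih]
    simp only [List.length_cons]
    rw [Fin.sum_univ_succ, Finsupp.mapDomain_finsetSum]
    simp only [Finsupp.mapDomain_smul, Finsupp.mapDomain_single, Fin.val_succ,
      List.eraseIdx_cons_succ, pow_succ, Fin.val_zero, pow_zero, one_smul,
      List.eraseIdx_cons_zero, mul_neg, mul_one, neg_smul, Finset.sum_neg_distrib]
    abel

theorem mapDomain_boundary (X : FramePoset S) (k : ℕ) (c : X.Chain (k + 1)) :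
    Finsupp.mapDomain (Subtype.val : X.Simplex k → List S) (X.boundary k c) =
      deltaLin (Finsupp.mapDomain (Subtype.val : X.Simplex (k + 1) → List S) c) := by
  induction c using Finsupp.induction_linear with
  | zero => simp
  | add x y hx hy =>
    rw [map_add, Finsupp.mapDomain_add, hx, hy, Finsupp.mapDomain_add, map_add]
  | single v r =>
    simp only [boundary, deltaLin, Finsupp.mapDomain_single, Finsupp.linearCombination_single,
      Finsupp.mapDomain_smul, Finsupp.mapDomain_finsetSum]
    rw [delta_eq]
    congr 1
    exact Fintype.sum_equiv (finCongr v.2.2.symm) _ _ (fun i => rfl)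

/-- `C_*(X)` is a complex. -/
theorem boundaries_le_cycles (X : FramePoset S) (k : ℕ) : X.boundaries k ≤ X.cycles k := by
  rintro _ ⟨c, rfl⟩
  cases k with
  | zero =>
    change X.augmentation (X.boundary 0 c) = 0
    induction c using Finsupp.induction_linear with
    | zero => simp
    | add x y hx hy => rw [map_add, map_add, hx, hy, add_zero]
    | single v r => simp [boundary, augmentation, Fin.sum_univ_succ]
  | succ k =>
    change X.boundary k (X.boundary (k + 1) c) = 0
    apply Finsupp.mapDomain_injective (Subtype.val_injective)
    rw [mapDomain_boundary, mapDomain_boundary, Finsupp.mapDomain_zero]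
    generalize Finsupp.mapDomain (Subtype.val : X.Simplex (k + 1 + 1) → List S) c = x
    induction x using Finsupp.induction_linear with
    | zero => simp
    | add x y hx hy => rw [map_add, map_add, hx, hy, add_zero]
    | single l r =>
      have : deltaLin (Finsupp.single l r) = r • delta l := by simp [deltaLin]
      rw [this, map_smul, deltaLin_delta, smul_zero]

/-- `H_k` of the augmented complex `C_*(X)`, `k ≥ 0`. -/
abbrev Homology (X : FramePoset S) (k : ℕ) : Type _ :=
  X.cycles k ⧸ (X.boundaries k).submoduleOf (X.cycles k)

/-- `X` is `d`-acyclic: `H_k(C_*(X)) = 0` for all `0 ≤ k ≤ d`. -/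
def IsAcyclic (X : FramePoset S) (d : ℤ) : Prop :=
  ∀ k : ℕ, (k : ℤ) ≤ d → Subsingleton (X.Homology k)

end FramePoset

/-! ### Unimodular sequences and lines -/

section Unimodular

variable (R : Type*) [CommRing R] {M : Type*} [AddCommGroup M] [Module R M]

/-- `v` is a basis of a free direct summand of `M`. -/
def IsUnimodularSeq (v : List M) : Prop :=
  LinearIndependent R v.get ∧ IsComplemented (Submodule.span R {x | x ∈ v})

variable {R}

theorem IsUnimodularSeq.sublist {u v : List M} (hv : IsUnimodularSeq R v) (h : u.Sublist v) :
    IsUnimodularSeq R u := by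
  obtain ⟨f, hf⟩ := List.sublist_iff_exists_fin_orderEmbedding_get_eq.1 h
  have hu : u.get = v.get ∘ f := funext hf
  refine ⟨hu ▸ hv.1.comp f f.injective, ?_⟩
  obtain ⟨C, hC⟩ := hv.2
  have e1 : {x | x ∈ u} = v.get '' Set.range f := by
    rw [← Set.range_comp, ← hu]; ext x; simp [List.mem_iff_get]
  have e2 : {x | x ∈ v} = v.get '' Set.range f ∪ v.get '' (Set.range f)ᶜ := by
    rw [← Set.image_union, Set.union_compl_self, Set.image_univ]; ext x; simp [List.mem_iff_get]
  have hd : Disjoint (Submodule.span R (v.get '' Set.range f))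
      (Submodule.span R (v.get '' (Set.range f)ᶜ)) :=
    hv.1.disjoint_span_image disjoint_compl_right
  rw [e2, Submodule.span_union] at hC
  rw [e1]
  refine ⟨Submodule.span R (v.get '' (Set.range f)ᶜ) ⊔ C, ?_, ?_⟩
  · exact hd.disjoint_sup_right_of_disjoint_sup_left hC.1
  · rw [codisjoint_iff, ← sup_assoc]
    exact hC.2.eq_top

theorem IsUnimodularSeq.nodup_lines [Nontrivial R] {v : List M} (hv : IsUnimodularSeq R v) :
    (v.map (fun x => Submodule.span R {x})).Nodup := by
  rw [List.nodup_iff_injective_get]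
  intro i j hij
  by_contra hne
  have hi : (i : ℕ) < v.length := by simpa using i.2
  have hj : (j : ℕ) < v.length := by simpa using j.2
  have h1 : Submodule.span R {v.get ⟨i, hi⟩} = Submodule.span R {v.get ⟨j, hj⟩} := by
    simpa using hij
  have h2 : v.get ⟨i, hi⟩ ∈ Submodule.span R (v.get '' {⟨j, hj⟩}) := by
    rw [Set.image_singleton, ← h1]; exact Submodule.mem_span_singleton_self _
  exact hv.1.notMem_span_image (by simpa [Fin.ext_iff] using fun h => hne (Fin.ext h)) h2

theorem IsUnimodularSeq.nodup [Nontrivial R] {v : List M} (hv : IsUnimodularSeq R v) : v.Nodup :=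
  hv.nodup_lines.of_map _

variable (R M)

/-- `U(M)`: the unimodular sequences in `M`. -/
def unimodularPoset [Nontrivial R] : FramePoset M where
  carrier := {v | v ≠ [] ∧ IsUnimodularSeq R v}
  subset_ordSeq := fun _ hv => ⟨hv.1, hv.2.nodup⟩
  chain := fun _ _ hv huv hu => ⟨hu, hv.2.sublist huv⟩

variable {M}

/-- The sequences of lines `(⟨v₁⟩, …, ⟨v_k⟩)` with `(v₁, …, v_k)` in `X`, for a poset `X` of
unimodular sequences. -/
def linePoset [Nontrivial R] (X : FramePoset M)
    (hX : X.carrier ⊆ (unimodularPoset R M).carrier) : FramePoset (Submodule R M) where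
  carrier := {L | ∃ v ∈ X.carrier, L = v.map (fun x => Submodule.span R {x})}
  subset_ordSeq := by
    rintro _ ⟨v, hv, rfl⟩
    exact ⟨by simpa using (hX hv).1, (hX hv).2.nodup_lines⟩
  chain := by
    rintro L _ ⟨v, hv, rfl⟩ h hL
    obtain ⟨u, hu, rfl⟩ := List.sublist_map_iff.1 h
    exact ⟨u, X.chain hv hu (by simpa using hL), rfl⟩

/-- The poset of sequences of lines `(⟨v₁⟩, …, ⟨v_k⟩)` with `(v₁, …, v_k) ∈ U(R^m)`. -/
def lineU [Nontrivial R] (m : ℕ) : FramePoset (Submodule R (Fin m → R)) :=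
  linePoset R (unimodularPoset R (Fin m → R)) subset_rfl

/-- The projective space `ℙ^{n-1}`: the lines `⟨v⟩` of `R^n` spanned by a unimodular vector. -/
def projSpace (n : ℕ) : Set (Submodule R (Fin n → R)) :=
  {L | ∃ v : Fin n → R, IsUnimodularSeq R [v] ∧ L = Submodule.span R {v}}

/-- `ℙ^{n-1}` as a set of lines of `R^m`, through the inclusion of `R^n = ⟨e₁, …, e_n⟩` in `R^m`
for `n ≤ m`. -/
def projSpaceIn {n m : ℕ} (hnm : n ≤ m) : Set (Submodule R (Fin m → R)) :=
  Submodule.map (Function.ExtendByZero.linearMap R (Fin.castLE hnm)) '' projSpace R n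

end Unimodular

/-! ### Hyperbolic spaces and isotropic frames -/

section Hyperbolic

variable {R : Type*} [CommRing R] [StarRing R]

/-- `Λ` is a form parameter for the involution `star` and `ε`:
`{r - ε r̄} ⊆ Λ ⊆ {r | ε r̄ = -r}` and `r̄ Λ r ⊆ Λ` for all `r`. -/
structure IsFormParameter (ε : R) (Λ : AddSubgroup R) : Prop where
  sub_mem : ∀ r : R, r - ε * star r ∈ Λ
  eq_neg : ∀ r ∈ Λ, ε * star r = -r
  conj_mem : ∀ r : R, ∀ a ∈ Λ, star r * a * r ∈ Λ

/-- The coordinate `x_{2i-1}` of `x ∈ R^{2n}` for the `i`-th index (`i = 1, …, n` in the usual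
numbering, `i = 0, …, n - 1` here). -/
def oddCoord {n : ℕ} (x : Fin (2 * n) → R) (i : Fin n) : R := x ⟨2 * i, by omega⟩

/-- The coordinate `x_{2i}` of `x ∈ R^{2n}`, with the same convention. -/
def evenCoord {n : ℕ} (x : Fin (2 * n) → R) (i : Fin n) : R := x ⟨2 * i + 1, by omega⟩

/-- The hyperbolic form `h(x, y) = ∑ i, (x̄_{2i-1} y_{2i} + ε x̄_{2i} y_{2i-1})`. -/
def hypForm (ε : R) {n : ℕ} (x y : Fin (2 * n) → R) : R :=
  ∑ i, (star (oddCoord x i) * evenCoord y i + ε * (star (evenCoord x i) * oddCoord y i))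

/-- The quadratic map `q(x) = ∑ i, x̄_{2i-1} x_{2i} mod Λ`. -/
def hypQuad (Λ : AddSubgroup R) {n : ℕ} (x : Fin (2 * n) → R) : R ⧸ Λ :=
  ((∑ i, star (oddCoord x i) * evenCoord x i : R) : R ⧸ Λ)

/-- A subset of `R^{2n}` is isotropic if `q` and `h` vanish on it. -/
def IsIsotropic (ε : R) (Λ : AddSubgroup R) {n : ℕ} (T : Set (Fin (2 * n) → R)) : Prop :=
  (∀ x ∈ T, hypQuad Λ x = 0) ∧ ∀ x ∈ T, ∀ y ∈ T, hypForm ε x y = 0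

/-- `IU(R^{2n})`: the sequences that are a basis of an isotropic free direct summand. -/
def isotropicUnimodularPoset [Nontrivial R] (ε : R) (Λ : AddSubgroup R) (n : ℕ) :
    FramePoset (Fin (2 * n) → R) where
  carrier := {v | v ∈ (unimodularPoset R (Fin (2 * n) → R)).carrier ∧
    IsIsotropic ε Λ (Submodule.span R {x | x ∈ v} : Set (Fin (2 * n) → R))}
  subset_ordSeq := fun _ hv => (unimodularPoset R _).subset_ordSeq hv.1
  chain := fun u v hv huv hu => by
    have hs : Submodule.span R {x | x ∈ u} ≤ Submodule.span R {x | x ∈ v} :=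
      Submodule.span_mono fun x hx => huv.subset hx
    exact ⟨(unimodularPoset R _).chain hv.1 huv hu, fun x hx => hv.2.1 x (hs hx),
      fun x hx y hy => hv.2.2 x (hs hx) y (hs hy)⟩

/-- The poset of sequences of lines `(⟨v₁⟩, …, ⟨v_k⟩)` with `(v₁, …, v_k) ∈ IU(R^{2n})`. -/
def lineIU [Nontrivial R] (ε : R) (Λ : AddSubgroup R) (n : ℕ) :
    FramePoset (Submodule R (Fin (2 * n) → R)) :=
  linePoset R (isotropicUnimodularPoset ε Λ n) fun _ hv => hv.1

end Hyperbolic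

/-! ### Chains on sets of sequences -/

namespace FramePoset

variable {S : Type*}

/-! Finite sequences, the empty one included, form the augmented complex, with length one more than
degree; acyclicity becomes `ExactAt` in lengths up to `d + 1`. Over a local ring unimodular
sequences are those independent modulo the maximal ideal (`ResidueIndependent`). Since the residue
field is infinite, a module is not a finite union of proper submodules
(`Submodule.exists_forall_notMem_of_ne_top`), so general position arguments are available.

For lines in a free module this is enough. A cycle involves finitely many frames, each, together
with `w`, of fewer than `n` vectors. A generic vector of `R^n` extends all of them at once, and the
cone over it fills the cycle (`exactAt_of_cone`, `isAcyclic_of_carrier_eq`).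

In the isotropic case a vector extends a frame only if it is orthogonal to it, so no cone is
available at the start. Instead `exists_isUnit_sesqForm` gives an isotropic `a` pairing to a unit
with every vector of the cycle. Entries of the cycle are then never orthogonal to `a`, and they are
replaced one at a time by vectors that are (`exists_deltaLin_eq_sum`): chains are written as sums of
`G ++ F`, with `F` made of old entries and `G` orthogonal to `a`. If the tails `F` are nonempty, the
coefficients are cycles; they are filled, and the filling moves the cycle to shorter tails. Once no
tail is left, appending `a` fills the cycle.

The coefficients can be filled by induction on the rank: `F^⊥/⟨F⟩` is hyperbolic of rank smaller by
the length of `F` (`exists_isReduction`), and each of its classes has a representative orthogonal to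
`a`, since some `f` in `F` pairs to a unit with `a`. To let `G` keep its original entries,
`exactAt_isIsotropicFrame` treats sequences in a set `A` with a map `π` onto vectors up to units.
The same generality passes from vectors to lines. -/

theorem delta_append (u v : List S) :
    delta (u ++ v) = Finsupp.mapDomain (· ++ v) (delta u) +
      (-1 : ℤ) ^ u.length • Finsupp.mapDomain (u ++ ·) (delta v) := by
  induction u with
  | nil =>
    simp only [List.nil_append, delta, Finsupp.mapDomain_zero, List.length_nil, pow_zero, one_smul,
      zero_add]
    exact Finsupp.mapDomain_id.symm
  | cons a u ih =>
    have h1 : (fun x : List S => a :: u ++ x) = List.cons a ∘ (u ++ ·) := rfl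
    have h2 : ((· ++ v) ∘ List.cons a : List S → List S) = List.cons a ∘ (· ++ v) := rfl
    have h3 (x y : List S →₀ ℤ) : Finsupp.mapDomain (· ++ v) (x - y) =
        Finsupp.mapDomain (· ++ v) x - Finsupp.mapDomain (· ++ v) y :=
      map_sub (Finsupp.mapDomain.addMonoidHom (· ++ v)) x y
    rw [List.cons_append, delta, ih, delta, Finsupp.mapDomain_add, h3, Finsupp.mapDomain_single,
      ← Finsupp.mapDomain_comp, ← Finsupp.mapDomain_comp, h2, h1, Finsupp.mapDomain_smul,
      ← Finsupp.mapDomain_comp, List.length_cons, pow_succ]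
    simp only [mul_neg, mul_one, neg_smul]
    abel

theorem deltaLin_single (l : List S) : deltaLin (Finsupp.single l 1) = delta l := by
  simp [deltaLin]

theorem deltaLin_deltaLin (x : List S →₀ ℤ) : deltaLin (deltaLin x) = 0 := by
  induction x using Finsupp.induction_linear with
  | zero => simp
  | add x y hx hy => rw [map_add, map_add, hx, hy, add_zero]
  | single l r =>
    have : deltaLin (Finsupp.single l r) = r • delta l := by simp [deltaLin]
    rw [this, map_smul, deltaLin_delta, smul_zero]

/-- The chains supported on the members of `C` of length `ℓ`. -/
noncomputable def chains (C : Set (List S)) (ℓ : ℕ) : Submodule ℤ (List S →₀ ℤ) :=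
  Finsupp.supported ℤ ℤ {l | l ∈ C ∧ l.length = ℓ}

/-- Every cycle in length `ℓ` is a boundary. -/
def ExactAt (C : Set (List S)) (ℓ : ℕ) : Prop :=
  ∀ z ∈ chains C ℓ, deltaLin z = 0 → ∃ y ∈ chains C (ℓ + 1), deltaLin y = z

theorem mem_chains {C : Set (List S)} {ℓ : ℕ} {x : List S →₀ ℤ} :
    x ∈ chains C ℓ ↔ ∀ l ∈ x.support, l ∈ C ∧ l.length = ℓ :=
  Finsupp.mem_supported _ _

theorem chains_mono {C D : Set (List S)} (h : C ⊆ D) (ℓ : ℕ) : chains C ℓ ≤ chains D ℓ :=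
  Finsupp.supported_mono fun _ hl => ⟨h hl.1, hl.2⟩

theorem mapDomain_mem_chains {C D : Set (List S)} {f : List S → List S} {ℓ k : ℕ}
    (hf : ∀ l ∈ C, l.length = ℓ → f l ∈ D ∧ (f l).length = k) {x : List S →₀ ℤ}
    (hx : x ∈ chains C ℓ) : Finsupp.mapDomain f x ∈ chains D k := by
  classical
  rw [mem_chains] at hx ⊢
  intro l hl
  obtain ⟨u, hu, rfl⟩ := Finset.mem_image.1 (Finsupp.mapDomain_support hl)
  exact hf u (hx u hu).1 (hx u hu).2

theorem chains_induction {C : Set (List S)} {ℓ : ℕ} {p : (List S →₀ ℤ) → Prop} (h0 : p 0)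
    (hadd : ∀ x y, p x → p y → p (x + y)) (hsmul : ∀ (c : ℤ) x, p x → p (c • x))
    (hs : ∀ l ∈ C, l.length = ℓ → p (Finsupp.single l 1)) {x : List S →₀ ℤ}
    (hx : x ∈ chains C ℓ) : p x := by
  rw [chains, Finsupp.supported_eq_span_single] at hx
  induction hx using Submodule.span_induction with
  | mem x hx => obtain ⟨l, hl, rfl⟩ := hx; exact hs l hl.1 hl.2
  | zero => exact h0
  | add x y _ _ hx hy => exact hadd x y hx hy
  | smul c x _ hx => exact hsmul c x hx

theorem deltaLin_mapDomain_append {C : Set (List S)} {ℓ : ℕ} (F : List S) {x : List S →₀ ℤ}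
    (hx : x ∈ chains C ℓ) :
    deltaLin (Finsupp.mapDomain (· ++ F) x) = Finsupp.mapDomain (· ++ F) (deltaLin x) +
      (-1 : ℤ) ^ ℓ • ∑ F' ∈ (delta F).support, delta F F' • Finsupp.mapDomain (· ++ F') x := by
  refine chains_induction (p := fun x => deltaLin (Finsupp.mapDomain (· ++ F) x) =
    Finsupp.mapDomain (· ++ F) (deltaLin x) + (-1 : ℤ) ^ ℓ •
      ∑ F' ∈ (delta F).support, delta F F' • Finsupp.mapDomain (· ++ F') x)
    ?_ (fun x y hx hy => ?_) (fun c x hx => ?_) (fun l _ hl => ?_) hx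
  · simp
  · simp only [Finsupp.mapDomain_add, map_add, hx, hy, smul_add, Finset.sum_add_distrib]
    abel
  · simp only [Finsupp.mapDomain_smul, map_smul, hx, smul_add, Finset.smul_sum]
    congr 1
    refine Finset.sum_congr rfl fun F' _ => ?_
    rw [smul_comm c, smul_comm c]
  · rw [Finsupp.mapDomain_single, deltaLin_single, deltaLin_single, delta_append, hl]
    congr 2
    simp only [Finsupp.mapDomain_single]
    rw [Finsupp.mapDomain, Finsupp.sum]
    simp

theorem sublist_of_mem_support_delta {F F' : List S} (h : F' ∈ (delta F).support) :
    F'.Sublist F ∧ F'.length + 1 = F.length := by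
  classical
  rw [delta_eq] at h
  obtain ⟨i, -, hi⟩ := Finset.mem_biUnion.1 (Finsupp.support_finsetSum h)
  have := Finsupp.support_single_subset (Finsupp.support_smul hi)
  rw [Finset.mem_singleton] at this
  subst this
  refine ⟨List.eraseIdx_sublist _ _, ?_⟩
  rw [List.length_eraseIdx_of_lt i.2]
  have := i.2
  omega

/-- Only the finitely many sequences in the support of one cycle need a common cone point, which may
therefore depend on the cycle. -/
theorem exactAt_of_cone {C : Set (List S)} {ℓ : ℕ}
    (h : ∀ t : Finset (List S), t.Nonempty → (∀ l ∈ t, l ∈ C ∧ l.length = ℓ) →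
      ∃ a, ∀ l ∈ t, a :: l ∈ C) :
    ExactAt C ℓ := by
  intro z hz hz0
  rcases eq_or_ne z 0 with rfl | hne
  · exact ⟨0, Submodule.zero_mem _, by simp⟩
  rw [mem_chains] at hz
  obtain ⟨a, ha⟩ := h z.support (Finsupp.support_nonempty_iff.2 hne) hz
  refine ⟨Finsupp.mapDomain (List.cons a) z, ?_, by rw [deltaLin_cons, hz0]; simp⟩
  refine mapDomain_mem_chains (C := {l | l ∈ z.support}) (ℓ := ℓ)
    (fun l hl hlen => ⟨ha l hl, by simp [hlen]⟩) ?_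
  exact mem_chains.2 fun l hl => ⟨hl, (hz l hl).2⟩

/-- The Leibniz rule, with the faces of the tails collected by face. The second sum again has the
form of the argument, with tails shorter by one, which is what the descent on tail length needs. -/
theorem deltaLin_sum_append {Y : List S → Set (List S)} {ℓ : ℕ} {t t' : Finset (List S)}
    {g : List S → List S →₀ ℤ} (hg : ∀ F ∈ t, g F ∈ chains (Y F) ℓ)
    (ht' : ∀ F ∈ t, (delta F).support ⊆ t') :
    deltaLin (∑ F ∈ t, Finsupp.mapDomain (· ++ F) (g F)) =
      ∑ F ∈ t, Finsupp.mapDomain (· ++ F) (deltaLin (g F)) +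
      (-1 : ℤ) ^ ℓ • ∑ F' ∈ t', Finsupp.mapDomain (· ++ F') (∑ F ∈ t, delta F F' • g F) := by
  simp only [map_sum, Finsupp.mapDomain_finsetSum, Finsupp.mapDomain_smul]
  rw [Finset.sum_comm (s := t'), Finset.smul_sum, ← Finset.sum_add_distrib]
  refine Finset.sum_congr rfl fun F hF => ?_
  rw [deltaLin_mapDomain_append F (hg F hF)]
  congr 2
  refine Finset.sum_subset (ht' F hF) fun F' _ hF' => ?_
  rw [Finsupp.notMem_support_iff.1 hF', zero_smul]

theorem append_left_injective' (F : List S) : Function.Injective (· ++ F : List S → List S) :=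
  fun _ _ h => List.append_cancel_right h

/-- A cycle of sequences `G ++ F`, with `F` outside and `G` inside `good`, bounds, provided that
the complexes `Y F` of admissible `G` are acyclic and `Y []` has the cone point `a`. -/
theorem exists_deltaLin_eq_sum {C T : Set (List S)} {Y : List S → Set (List S)} {good : Set S}
    {a : S} {d : ℕ} (hT : ∀ F ∈ T, ∀ F', F'.Sublist F → F' ∈ T)
    (hbad : ∀ F ∈ T, ∀ s ∈ F, s ∉ good) (hgood : ∀ F ∈ T, ∀ G ∈ Y F, ∀ s ∈ G, s ∈ good)
    (hmono : ∀ F ∈ T, ∀ F', F'.Sublist F → Y F ⊆ Y F') (hC : ∀ F ∈ T, ∀ G ∈ Y F, G ++ F ∈ C)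
    (hcone : ∀ G ∈ Y [], G ++ [a] ∈ C)
    (hex : ∀ F ∈ T, F ≠ [] → ∀ ℓ, ℓ + F.length < d → ExactAt (Y F) ℓ) (j : ℕ) :
    ∀ ℓ, ℓ + j < d → ∀ (t : Finset (List S)) (g : List S → List S →₀ ℤ),
      (∀ F ∈ t, F ∈ T ∧ F.length = j) → (∀ F ∈ t, g F ∈ chains (Y F) ℓ) →
      deltaLin (∑ F ∈ t, Finsupp.mapDomain (· ++ F) (g F)) = 0 →
      ∃ y ∈ chains C (ℓ + j + 1), deltaLin y = ∑ F ∈ t, Finsupp.mapDomain (· ++ F) (g F) := by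
  classical
  induction j with
  | zero =>
    intro ℓ _ t g ht hg h0
    set x := ∑ F ∈ t, Finsupp.mapDomain (· ++ F) (g F) with hx
    have hxm : x ∈ chains (Y []) ℓ := by
      refine Submodule.sum_mem _ fun F hF => ?_
      obtain rfl : F = [] := List.length_eq_zero_iff.1 (ht F hF).2
      exact mapDomain_mem_chains (fun l hl hlen => by simpa using ⟨hl, hlen⟩) (hg _ hF)
    -- The cone is taken at the end of the sequence, where deleting `a` carries the sign `(-1) ^ ℓ`.
    refine ⟨(-1 : ℤ) ^ ℓ • Finsupp.mapDomain (· ++ [a]) x, Submodule.smul_mem _ _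
      (mapDomain_mem_chains (fun l hl hlen => ⟨hcone l hl, by simp [hlen]⟩) hxm), ?_⟩
    have hd : delta [a] = Finsupp.single [] 1 := by simp [delta]
    have hid : Finsupp.mapDomain (fun l : List S => l) x = x := Finsupp.mapDomain_id
    rw [map_smul, deltaLin_mapDomain_append [a] hxm, h0, hd,
      Finsupp.support_single _ one_ne_zero]
    simp [smul_smul, ← mul_pow, hid]
  | succ j ih =>
    intro ℓ hℓ t g ht hg h0
    set t' := t.biUnion fun F => (delta F).support with ht'
    have hsub : ∀ F ∈ t, (delta F).support ⊆ t' := fun F hF =>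
      Finset.subset_biUnion_of_mem (fun F => (delta F).support) hF
    -- The coefficient at `G ++ F` of the vanishing boundary. Tails of full length other than `F`
    -- cannot contribute; the terms with shortened tails are excluded next.
    have hcyc : ∀ F ∈ t, deltaLin (g F) = 0 := by
      intro F hF
      ext G
      have h1 := DFunLike.congr_fun h0 (G ++ F)
      rw [deltaLin_sum_append hg hsub, Finsupp.add_apply, Finsupp.finsetSum_apply,
        Finsupp.smul_apply, Finsupp.finsetSum_apply, Finset.sum_eq_single F] at h1
      · rw [Finsupp.mapDomain_apply (append_left_injective' F)] at h1
        refine Eq.trans ?_ h1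
        rw [left_eq_add]
        refine smul_eq_zero_of_right _ (Finset.sum_eq_zero fun F' hF' => ?_)
        rw [Finsupp.mapDomain_finsetSum, Finsupp.finsetSum_apply]
        refine Finset.sum_eq_zero fun F₁ hF₁ => ?_
        rw [Finsupp.mapDomain_smul, Finsupp.smul_apply]
        refine smul_eq_zero_of_right _ (Finsupp.notMem_support_iff.1 fun hmem => ?_)
        obtain ⟨G', hG', he⟩ := Finset.mem_image.1 (Finsupp.mapDomain_support hmem)
        obtain ⟨F₂, hF₂, hF'₂⟩ := Finset.mem_biUnion.1 hF'
        have hlen := (sublist_of_mem_support_delta hF'₂).2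
        rw [(ht F₂ hF₂).2] at hlen
        -- The tail `F'` is one shorter than `F`, so the first entry of `F` would be the last entry
        -- of `G'`, hence both outside and inside `good`.
        rcases List.append_eq_append_iff.1 he with ⟨as, _, h⟩ | ⟨bs, h, h'⟩
        · have := congrArg List.length h
          rw [List.length_append, (ht F hF).2] at this
          omega
        · have := congrArg List.length h'
          rw [List.length_append, (ht F hF).2] at this
          obtain ⟨b, rfl⟩ := List.length_eq_one_iff.1 (show bs.length = 1 by omega)
          exact hbad F (ht F hF).1 b (by simp [h'])
            (hgood F₁ (ht F₁ hF₁).1 G' ((mem_chains.1 (hg F₁ hF₁)) G' hG').1 b (by simp [h]))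
      · intro F' hF' hne
        refine Finsupp.mapDomain_of_notMem_range _ _ ?_
        rintro ⟨G', he⟩
        exact hne (List.append_inj' he (by rw [(ht F' hF').2, (ht F hF).2])).2
      · exact fun h => absurd hF h
    have hfill : ∀ F, ∃ e, F ∈ t → e ∈ chains (Y F) (ℓ + 1) ∧ deltaLin e = g F := by
      intro F
      by_cases hF : F ∈ t
      · have hne : F ≠ [] := by
          rintro rfl
          have := (ht _ hF).2
          simp at this
        obtain ⟨e, he, he'⟩ := hex F (ht F hF).1 hne ℓ (by rw [(ht F hF).2]; exact hℓ) (g F)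
          (hg F hF) (hcyc F hF)
        exact ⟨e, fun _ => ⟨he, he'⟩⟩
      · exact ⟨0, fun h => absurd h hF⟩
    choose e he using hfill
    -- Filling the coefficients shows that the given cycle is, up to sign, homologous to one whose
    -- tails have length `j`.
    have hkey := deltaLin_sum_append (t' := t') (fun F hF => (he F hF).1) hsub
    have hzg : ∑ F ∈ t, Finsupp.mapDomain (· ++ F) (deltaLin (e F)) =
        ∑ F ∈ t, Finsupp.mapDomain (· ++ F) (g F) :=
      Finset.sum_congr rfl fun F hF => by rw [(he F hF).2]
    rw [hzg] at hkey
    set w := ∑ F ∈ t, Finsupp.mapDomain (· ++ F) (e F) with hw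
    set z := ∑ F ∈ t, Finsupp.mapDomain (· ++ F) (g F) with hz
    set z' := ∑ F' ∈ t', Finsupp.mapDomain (· ++ F') (∑ F ∈ t, delta F F' • e F) with hz'
    have hsq : (-1 : ℤ) ^ (ℓ + 1) * (-1) ^ (ℓ + 1) = 1 := by rw [← mul_pow]; simp
    have hz'0 : deltaLin z' = 0 := by
      have h1 := congrArg deltaLin hkey
      rw [deltaLin_deltaLin, map_add, h0, zero_add, map_smul] at h1
      have h2 := congrArg ((-1 : ℤ) ^ (ℓ + 1) • ·) h1.symm
      simpa only [smul_smul, hsq, one_smul, smul_zero] using h2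
    obtain ⟨y, hy, hyz⟩ := ih (ℓ + 1) (by omega) t' (fun F' => ∑ F ∈ t, delta F F' • e F)
      (fun F' hF' => by
        obtain ⟨F, hF, hF'⟩ := Finset.mem_biUnion.1 hF'
        obtain ⟨h1, h2⟩ := sublist_of_mem_support_delta hF'
        refine ⟨hT F (ht F hF).1 F' h1, ?_⟩
        rw [(ht F hF).2] at h2
        omega)
      (fun F' _ => by
        refine Submodule.sum_mem _ fun F hF => ?_
        by_cases h : F' ∈ (delta F).support
        · exact Submodule.smul_mem _ _ (chains_mono
            (hmono F (ht F hF).1 F' (sublist_of_mem_support_delta h).1) _ (he F hF).1)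
        · rw [Finsupp.notMem_support_iff.1 h, zero_smul]
          exact Submodule.zero_mem _)
      hz'0
    refine ⟨w - (-1 : ℤ) ^ (ℓ + 1) • y, Submodule.sub_mem _ ?_ (Submodule.smul_mem _ _ ?_), ?_⟩
    · refine Submodule.sum_mem _ fun F hF => ?_
      refine mapDomain_mem_chains (fun G hG hlen => ⟨hC F (ht F hF).1 G hG, ?_⟩) (he F hF).1
      rw [List.length_append, hlen, (ht F hF).2]
      omega
    · convert hy using 2
      omega
    · rw [map_sub, map_smul, hyz, hkey, ← hz']
      abel

/-- The starting point of the descent: the whole sequence is tail, with the empty sequence in front.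
-/
theorem exists_deltaLin_eq {C T : Set (List S)} {Y : List S → Set (List S)} {good : Set S}
    {a : S} {d ℓ : ℕ} (hT : ∀ F ∈ T, ∀ F', F'.Sublist F → F' ∈ T)
    (hbad : ∀ F ∈ T, ∀ s ∈ F, s ∉ good) (hgood : ∀ F ∈ T, ∀ G ∈ Y F, ∀ s ∈ G, s ∈ good)
    (hmono : ∀ F ∈ T, ∀ F', F'.Sublist F → Y F ⊆ Y F') (hC : ∀ F ∈ T, ∀ G ∈ Y F, G ++ F ∈ C)
    (hcone : ∀ G ∈ Y [], G ++ [a] ∈ C)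
    (hex : ∀ F ∈ T, F ≠ [] → ∀ ℓ, ℓ + F.length < d → ExactAt (Y F) ℓ)
    (hnil : ∀ F ∈ T, [] ∈ Y F) (hℓ : ℓ < d) {z : List S →₀ ℤ} (hz : z ∈ chains T ℓ)
    (h0 : deltaLin z = 0) : ∃ y ∈ chains C (ℓ + 1), deltaLin y = z := by
  have hsum : ∑ F ∈ z.support, Finsupp.mapDomain (· ++ F) (Finsupp.single ([] : List S) (z F)) =
      z := by
    simp only [Finsupp.mapDomain_single, List.nil_append]
    exact Finsupp.sum_single z
  have := exists_deltaLin_eq_sum hT hbad hgood hmono hC hcone hex ℓ 0 (by omega) z.support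
    (fun F => Finsupp.single [] (z F)) (mem_chains.1 hz)
    (fun F hF => mem_chains.2 fun l hl => by
      obtain rfl : l = [] := Finset.mem_singleton.1 (Finsupp.support_single_subset hl)
      exact ⟨hnil F ((mem_chains.1 hz) F hF).1, rfl⟩)
    (by rw [hsum, h0])
  rwa [hsum, zero_add] at this

/-- The empty list generates degree `-1`, so `deltaLin` on lists of length one is the augmentation
and degree `k` is length `k + 1`. -/
theorem homology_subsingleton (X : FramePoset S) (k : ℕ)
    (h : ExactAt {l | l = [] ∨ l ∈ X.carrier} (k + 1)) : Subsingleton (X.Homology k) := by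
  classical
  rw [Submodule.Quotient.subsingleton_iff, Submodule.submoduleOf_eq_top]
  intro z hz
  have hval : ∀ (j : ℕ) (x : X.Chain j), Finsupp.mapDomain Subtype.val x ∈
      chains {l | l = [] ∨ l ∈ X.carrier} (j + 1) := by
    intro j x
    rw [mem_chains]
    intro l hl
    obtain ⟨u, _, rfl⟩ := Finset.mem_image.1 (Finsupp.mapDomain_support hl)
    exact ⟨Or.inr u.2.1, u.2.2⟩
  have h0 : deltaLin (Finsupp.mapDomain Subtype.val z) = 0 := by
    cases k with
    | zero =>
      have haug : ∀ x : X.Chain 0, deltaLin (Finsupp.mapDomain Subtype.val x) =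
          Finsupp.single [] (X.augmentation x) := by
        intro x
        induction x using Finsupp.induction_linear with
        | zero => simp
        | add x y hx hy =>
          rw [Finsupp.mapDomain_add, map_add, hx, hy, map_add, Finsupp.single_add]
        | single v r =>
          obtain ⟨v, hv, hlen⟩ := v
          obtain ⟨b, rfl⟩ := List.length_eq_one_iff.1 hlen
          simp [deltaLin, augmentation, delta]
      rw [haug, show X.augmentation z = 0 from hz, Finsupp.single_zero]
    | succ k =>
      rw [← mapDomain_boundary, show X.boundary k z = 0 from hz, Finsupp.mapDomain_zero]
  obtain ⟨y, hy, hyz⟩ := h _ (hval k z) h0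
  have hrange : (y.support : Set (List S)) ⊆ Set.range (Subtype.val : X.Simplex (k + 1) → _) := by
    intro l hl
    obtain ⟨h1 | h1, h2⟩ := mem_chains.1 hy l hl
    · simp [h1] at h2
    · exact ⟨⟨l, h1, h2⟩, rfl⟩
  refine ⟨Finsupp.comapDomain Subtype.val y Subtype.val_injective.injOn, ?_⟩
  apply Finsupp.mapDomain_injective Subtype.val_injective
  rw [mapDomain_boundary, Finsupp.mapDomain_comapDomain _ Subtype.val_injective _ hrange, hyz]

theorem isAcyclic_of_exactAt (X : FramePoset S) (d : ℤ)
    (h : ∀ ℓ : ℕ, 0 < ℓ → (ℓ : ℤ) ≤ d + 1 → ExactAt {l | l = [] ∨ l ∈ X.carrier} ℓ) :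
    X.IsAcyclic d :=
  fun k hk => X.homology_subsingleton k (h (k + 1) (by omega) (by push_cast; omega))

end FramePoset

/-! ### Unimodular sequences over a local ring -/

section LocalRing

open IsLocalRing

variable {R : Type*} [CommRing R] [IsLocalRing R] {M M' : Type*} [AddCommGroup M] [Module R M]
  [AddCommGroup M'] [Module R M']

/-- Over a local ring with infinite residue field, a module is not a finite union of proper
submodules. -/
theorem Submodule.exists_forall_notMem_of_ne_top [Infinite (ResidueField R)] {ι : Type*}
    (s : Finset ι) (P : ι → Submodule R M) (hP : ∀ i ∈ s, P i ≠ ⊤) : ∃ v, ∀ i ∈ s, v ∉ P i := by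
  classical
  induction s using Finset.induction_on with
  | empty => exact ⟨0, by simp⟩
  | insert i s _ ih =>
    obtain ⟨v, hv⟩ := ih fun j hj => hP j (Finset.mem_insert_of_mem hj)
    obtain ⟨u, -, hu⟩ := SetLike.exists_of_lt (hP i (Finset.mem_insert_self i s)).lt_top
    -- On the line `v + t • u` each submodule is met in at most one residue class of `t`: two
    -- classes would differ by a unit and force both `u` and `v` into it. Infinitely many classes
    -- thus remain.
    have hB : ∀ j ∈ insert i s,
        {r : ResidueField R | ∃ t, residue R t = r ∧ v + t • u ∈ P j}.Subsingleton := by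
      rintro j hj _ ⟨t, rfl, ht⟩ _ ⟨t', rfl, ht'⟩
      by_contra hne
      have hunit : IsUnit (t - t') := by
        rw [← residue_ne_zero_iff_isUnit, map_sub]
        exact sub_ne_zero.2 hne
      have huj : u ∈ P j := by
        have h := (P j).sub_mem ht ht'
        rw [add_sub_add_left_eq_sub, ← sub_smul] at h
        exact ((P j).smul_mem_iff_of_isUnit hunit).1 h
      rcases Finset.mem_insert.1 hj with rfl | hj
      · exact hu huj
      · exact hv j hj (by simpa using (P j).sub_mem ht ((P j).smul_mem t huj))
    obtain ⟨r, hr⟩ := ((insert i s).finite_toSet.biUnion fun j hj =>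
      (hB j hj).finite).infinite_compl.nonempty
    obtain ⟨t, rfl⟩ := residue_surjective r
    refine ⟨v + t • u, fun j hj hmem => hr ?_⟩
    exact Set.mem_biUnion (Finset.mem_coe.2 hj) ⟨t, rfl, hmem⟩

theorem LinearMap.apply_mem_maximalIdeal_smul_top (f : M →ₗ[R] M') {x : M}
    (hx : x ∈ maximalIdeal R • (⊤ : Submodule R M)) :
    f x ∈ maximalIdeal R • (⊤ : Submodule R M') :=
  Submodule.smul_top_le_comap_smul_top _ f hx

theorem LinearMap.apply_mem_maximalIdeal (f : M →ₗ[R] R) {x : M}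
    (hx : x ∈ maximalIdeal R • (⊤ : Submodule R M)) : f x ∈ maximalIdeal R := by
  simpa using f.apply_mem_maximalIdeal_smul_top hx

theorem Module.Basis.mem_maximalIdeal_smul_top {ι : Type*} [Fintype ι] (b : Module.Basis ι R M)
    {x : M} (h : ∀ i, b.repr x i ∈ maximalIdeal R) :
    x ∈ maximalIdeal R • (⊤ : Submodule R M) := by
  rw [← b.sum_repr x]
  exact Submodule.sum_mem _ fun i _ => Submodule.smul_mem_smul (h i) trivial

variable (R) in
/-- The sequence is linearly independent modulo the maximal ideal. -/
def ResidueIndependent : List M → Prop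
  | [] => True
  | x :: l => x ∉ Submodule.span R {y | y ∈ l} ⊔ maximalIdeal R • (⊤ : Submodule R M) ∧
      ResidueIndependent l

theorem List.span_cons {A N : Type*} [Semiring A] [AddCommMonoid N] [Module A N] (x : N)
    (l : List N) :
    Submodule.span A {y | y ∈ x :: l} = Submodule.span A {x} ⊔ Submodule.span A {y | y ∈ l} := by
  rw [← Submodule.span_insert]
  congr 1
  ext y
  simp

namespace ResidueIndependent

theorem sublist {u v : List M} (huv : u.Sublist v) (hv : ResidueIndependent R v) :
    ResidueIndependent R u := by
  induction huv with
  | slnil => trivial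
  | cons a _ ih => exact ih hv.2
  | @cons_cons l₁ l₂ a h ih =>
    refine ⟨fun ha => hv.1 ?_, ih hv.2⟩
    have hle := Submodule.span_mono (R := R) (s := {x | x ∈ l₁}) (t := {x | x ∈ l₂})
      fun _ hx => h.subset hx
    exact sup_le_sup_right hle (maximalIdeal R • ⊤) ha

/-- Steinitz exchange for two neighbours: in a relation `x = c • y + s` the coefficient `c` is
either in the maximal ideal or a unit, and both contradict independence in the other order. -/
theorem perm {u v : List M} (huv : u.Perm v) (hu : ResidueIndependent R u) :
    ResidueIndependent R v := by
  induction huv with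
  | nil => trivial
  | cons a h ih =>
    refine ⟨?_, ih hu.2⟩
    simp only [← h.mem_iff]
    exact hu.1
  | swap x y l =>
    obtain ⟨hy, hx, hl⟩ := hu
    rw [List.span_cons, sup_assoc] at hy
    refine ⟨fun h => ?_, fun h => hy (Submodule.mem_sup_right h), hl⟩
    rw [List.span_cons, sup_assoc] at h
    obtain ⟨a, ha, s, hs, rfl⟩ := Submodule.mem_sup.1 h
    obtain ⟨c, rfl⟩ := Submodule.mem_span_singleton.1 ha
    by_cases hc : c ∈ maximalIdeal R
    · exact hx (Submodule.add_mem _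
        (Submodule.mem_sup_right (Submodule.smul_mem_smul hc trivial)) hs)
    · rw [notMem_maximalIdeal] at hc
      refine hy ((Submodule.smul_mem_iff_of_isUnit _ hc).1 ?_)
      have := Submodule.sub_mem _ (Submodule.mem_sup_left
        (Submodule.mem_span_singleton_self (R := R) (c • y + s))) (Submodule.mem_sup_right hs)
      rwa [add_sub_cancel_right] at this
  | trans _ _ ih₁ ih₂ => exact ih₂ (ih₁ hu)

theorem notMem {l : List M} (hl : ResidueIndependent R l) {x : M} (hx : x ∈ l) :
    x ∉ maximalIdeal R • (⊤ : Submodule R M) := by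
  have := sublist (List.singleton_sublist.2 hx) hl
  simpa [ResidueIndependent] using this

theorem singleton_iff {x : M} :
    ResidueIndependent R [x] ↔ x ∉ maximalIdeal R • (⊤ : Submodule R M) := by
  simp [ResidueIndependent]

/-- A linear map whose kernel on `P` is, modulo the maximal ideal, spanned by `w`. -/
theorem append_iff_map (ρ : M →ₗ[R] M') (P : Submodule R M) {w : List M}
    (hw : ResidueIndependent R w) (hρw : ∀ x ∈ w, ρ x = 0)
    (hker : ∀ x ∈ P, ρ x ∈ maximalIdeal R • (⊤ : Submodule R M') →
      x ∈ Submodule.span R {y | y ∈ w} ⊔ maximalIdeal R • (⊤ : Submodule R M))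
    {l : List M} (hl : ∀ x ∈ l, x ∈ P) :
    ResidueIndependent R (l ++ w) ↔ ResidueIndependent R (l.map ρ) := by
  induction l with
  | nil => simpa [ResidueIndependent] using hw
  | cons x l ih =>
    rw [List.forall_mem_cons] at hl
    have hset : {y | y ∈ l.map ρ} = ρ '' {y | y ∈ l} := by ext; simp
    have hset' : {y | y ∈ l ++ w} = {y | y ∈ l} ∪ {y | y ∈ w} := by ext; simp
    rw [List.cons_append, List.map_cons, ResidueIndependent, ResidueIndependent, ih hl.2,
      hset, Submodule.span_image, hset', Submodule.span_union, sup_assoc]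
    refine and_congr_left fun _ => not_congr ⟨fun h => ?_, fun h => ?_⟩
    · obtain ⟨a, ha, b, hb, rfl⟩ := Submodule.mem_sup.1 h
      obtain ⟨c, hc, e, he, rfl⟩ := Submodule.mem_sup.1 hb
      have hc0 : ρ c = 0 :=
        (Submodule.span_le.2 hρw : Submodule.span R {y | y ∈ w} ≤ LinearMap.ker ρ) hc
      rw [map_add, map_add, hc0, zero_add]
      exact Submodule.add_mem_sup (Submodule.mem_map_of_mem ha)
        (ρ.apply_mem_maximalIdeal_smul_top he)
    · obtain ⟨_, ⟨a, ha, rfl⟩, e, he, hae⟩ := Submodule.mem_sup.1 h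
      have haP : a ∈ P := (Submodule.span_le.2 hl.2 : Submodule.span R {y | y ∈ l} ≤ P) ha
      have := hker (x - a) (P.sub_mem hl.1 haP) (by rwa [map_sub, ← hae, add_sub_cancel_left])
      rw [← add_sub_cancel a x]
      exact Submodule.add_mem_sup ha this

end ResidueIndependent

theorem List.range_get_eq {α : Type*} (l : List α) : Set.range l.get = {x | x ∈ l} := by
  ext x
  simp [List.mem_iff_get]

/-- Projecting a forbidden relation onto `⟨x⟩` along a complement containing the other vectors gives
`x = c • x` with `c` in the maximal ideal, so `x = 0`. -/
theorem IsUnimodularSeq.residueIndependent {l : List M} (hl : IsUnimodularSeq R l) :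
    ResidueIndependent R l := by
  induction l with
  | nil => trivial
  | cons x l ih =>
    refine ⟨fun hx => ?_, ih (hl.sublist (List.sublist_cons_self x l))⟩
    have hd : Disjoint (Submodule.span R {x}) (Submodule.span R {y | y ∈ l}) := by
      have h := hl.1.disjoint_span_image (s := {0}) (t := {0}ᶜ) disjoint_compl_right
      have e : {y | y ∈ l} ⊆ (x :: l).get '' {0}ᶜ := by
        intro y hy
        obtain ⟨i, rfl⟩ := List.mem_iff_get.1 hy
        exact ⟨i.succ, by simp, by simp⟩
      rw [Set.image_singleton] at h
      exact h.mono_right (Submodule.span_mono e)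
    obtain ⟨C, hC⟩ := hl.2
    rw [List.span_cons] at hC
    have hc : IsCompl (Submodule.span R {x}) (Submodule.span R {y | y ∈ l} ⊔ C) :=
      ⟨hd.disjoint_sup_right_of_disjoint_sup_left hC.1, by
        rw [codisjoint_iff, ← sup_assoc]; exact hC.2.eq_top⟩
    obtain ⟨s, hs, e, he, hse⟩ := Submodule.mem_sup.1 hx
    set p := Submodule.projection _ _ hc with hp
    have hpx : p x = x := Submodule.projection_apply_left hc ⟨x, Submodule.mem_span_singleton_self x⟩
    have hps : p s = 0 := (Submodule.projection_apply_eq_zero_iff hc).2 (Submodule.mem_sup_left hs)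
    have hpe : p e ∈ maximalIdeal R • Submodule.span R {x} := by
      have := Submodule.mem_map_of_mem (f := p) he
      rw [Submodule.map_smul'', Submodule.map_top] at this
      have hle : LinearMap.range p ≤ Submodule.span R {x} := by
        rintro _ ⟨y, rfl⟩
        exact Submodule.projection_apply_mem hc y
      exact Submodule.smul_mono le_rfl hle this
    obtain ⟨c, hcm, hcx⟩ := Submodule.mem_smul_span_singleton.1 hpe
    have hx0 : (1 - c) • x = 0 := by
      rw [sub_smul, one_smul, hcx, sub_eq_zero]
      calc x = p x := hpx.symm
        _ = p e := by rw [← hse, map_add, hps, zero_add]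
    have hunit : IsUnit (1 - c) := by
      rw [← notMem_maximalIdeal]
      exact fun h => (Ideal.ne_top_iff_one _).1 (maximalIdeal.isMaximal R).ne_top
        (by simpa using Ideal.add_mem _ h hcm)
    exact hl.1.ne_zero (0 : Fin (l.length + 1)) ((hunit.smul_eq_zero).1 hx0)

/-- Induction on the sequence: a functional `ψ` with value `1` on the new vector and `0` on the old
ones yields independence, and cutting the old complement by `ker ψ` gives the new one. -/
theorem ResidueIndependent.isUnimodularSeq {ι : Type*} [Fintype ι] (b : Module.Basis ι R M)
    {l : List M} (hl : ResidueIndependent R l) : IsUnimodularSeq R l := by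
  induction l with
  | nil =>
    refine ⟨(linearIndependent_empty_type (ι := Fin 0)), ⊤, ?_⟩
    simpa using isCompl_bot_top
  | cons x l ih =>
    obtain ⟨hli, C, hC⟩ := ih hl.2
    set p := Submodule.projection _ _ hC.symm with hp
    have hpC : ∀ y, p y ∈ C := Submodule.projection_apply_mem hC.symm
    have hpl : ∀ y ∈ Submodule.span R {y | y ∈ l}, p y = 0 := fun y hy =>
      (Submodule.projection_apply_eq_zero_iff hC.symm).2 hy
    have hpc : ∀ y ∈ C, p y = y := fun y hy => Submodule.projection_apply_left hC.symm ⟨y, hy⟩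
    have hps : ∀ y, y - p y ∈ Submodule.span R {y | y ∈ l} := fun y => by
      rw [← Submodule.projection_apply_eq_zero_iff hC.symm, map_sub, ← hp, hpc _ (hpC y), sub_self]
    -- The projection of `x` to the old complement is nonzero modulo the maximal ideal, so it has a
    -- unit coordinate, which is normalised to give `ψ`.
    obtain ⟨i, hi⟩ : ∃ i, b.repr (p x) i ∉ maximalIdeal R := by
      by_contra! h
      refine hl.1 ?_
      rw [← sub_add_cancel x (p x)]
      exact Submodule.add_mem_sup (hps x) (b.mem_maximalIdeal_smul_top h)
    obtain ⟨u, hu⟩ := notMem_maximalIdeal.1 hi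
    set ψ : M →ₗ[R] R := (↑u⁻¹ : R) • (b.coord i ∘ₗ p) with hψ
    have hψx : ψ x = 1 := by simp [hψ, ← hu]
    have hψl : ∀ y ∈ Submodule.span R {y | y ∈ l}, ψ y = 0 := fun y hy => by
      simp [hψ, hpl y hy]
    constructor
    · have : (x :: l).get = Fin.cons x l.get := by
        ext j
        refine Fin.cases ?_ (fun j => ?_) j <;> simp
      rw [this]
      refine LinearIndependent.finCons' x _ hli fun c y hy h0 => ?_
      rw [List.range_get_eq] at hy
      simpa [hψx, hψl y hy] using congrArg ψ h0
    · rw [List.span_cons]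
      refine ⟨C ⊓ LinearMap.ker ψ, ?_, ?_⟩
      · rw [Submodule.disjoint_def]
        rintro y hy ⟨hyC, hyψ⟩
        obtain ⟨a, ha, s, hs, rfl⟩ := Submodule.mem_sup.1 hy
        obtain ⟨c, rfl⟩ := Submodule.mem_span_singleton.1 ha
        have hc : c = 0 := by simpa [hψx, hψl s hs] using hyψ
        rw [hc, zero_smul, zero_add] at hyC ⊢
        exact Submodule.disjoint_def.1 hC.1 s hs hyC
      · rw [codisjoint_iff, eq_top_iff]
        rintro y -
        have h1 := hps (y - ψ y • x)
        have h2 : p (y - ψ y • x) ∈ C ⊓ LinearMap.ker ψ := by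
          refine ⟨hpC _, ?_⟩
          have := hψl _ h1
          rw [map_sub, sub_eq_zero] at this
          change ψ _ = 0
          rw [← this]
          simp [hψx]
        have h3 := Submodule.add_mem_sup (Submodule.add_mem_sup
          (Submodule.smul_mem _ (ψ y) (Submodule.mem_span_singleton_self x)) h1) h2
        convert h3 using 1
        abel

end LocalRing

/-! ### Frames of lines in a free module -/

section Lines

open IsLocalRing

variable {R : Type*} [CommRing R] [IsLocalRing R]

/-- Over the residue field, `n` independent basis vectors do not lie in the span of fewer than `n`
vectors. -/
theorem comap_span_sup_ne_top {n m : ℕ} (hnm : n ≤ m) {f : List (Fin m → R)}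
    (hf : f.length < n) :
    (Submodule.span R {x | x ∈ f} ⊔ maximalIdeal R • (⊤ : Submodule R (Fin m → R))).comap
      (Function.ExtendByZero.linearMap R (Fin.castLE hnm)) ≠ ⊤ := by
  classical
  intro htop
  set red : (Fin m → R) →ₗ[R] (Fin m → ResidueField R) :=
    (Algebra.linearMap R (ResidueField R)).compLeft (Fin m) with hred
  set W := Submodule.span (ResidueField R) ((f.map red).toFinset : Set (Fin m → ResidueField R))
  have hle : Submodule.span R {x | x ∈ f} ⊔ maximalIdeal R • (⊤ : Submodule R (Fin m → R)) ≤
      (W.restrictScalars R).comap red := by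
    refine sup_le (Submodule.span_le.2 fun x hx => ?_) (Submodule.smul_le.2 fun r hr x _ => ?_)
    · exact Submodule.subset_span (by simpa using ⟨x, hx, rfl⟩)
    · have : red (r • x) = 0 := by
        ext i
        have hr0 : residue R r = 0 := (residue_eq_zero_iff r).2 hr
        simp [hred, ResidueField.algebraMap_eq, hr0]
      rw [Submodule.mem_comap, this]
      exact Submodule.zero_mem _
  have hmem : Set.range (fun i : Fin n => Pi.single (Fin.castLE hnm i) (1 : ResidueField R)) ⊆
      (W : Set (Fin m → ResidueField R)) := by
    rintro _ ⟨i, rfl⟩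
    have h1 : (Pi.single i 1 : Fin n → R) ∈ (⊤ : Submodule R (Fin n → R)) := trivial
    rw [← htop] at h1
    have h2 := hle h1
    have hinj : Function.Injective (Fin.castLE hnm) := Fin.castLE_injective hnm
    have h3 : red (Function.ExtendByZero.linearMap R (Fin.castLE hnm) (Pi.single i 1)) =
        Pi.single (Fin.castLE hnm i) (1 : ResidueField R) := by
      ext j
      have h4 : Function.extend (Fin.castLE hnm) (Pi.single i (1 : R)) 0 j =
          (Pi.single (Fin.castLE hnm i) (1 : R) : Fin m → R) j := by
        by_cases hj : ∃ a, Fin.castLE hnm a = j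
        · obtain ⟨a, rfl⟩ := hj
          rw [hinj.extend_apply, Pi.single_apply, Pi.single_apply]
          simp [hinj.eq_iff]
        · rw [Function.extend_apply' _ _ _ hj, Pi.single_eq_of_ne]
          · rfl
          · rintro rfl
            exact hj ⟨i, rfl⟩
      change algebraMap R (ResidueField R)
        (Function.extend (Fin.castLE hnm) (Pi.single i (1 : R)) 0 j) = _
      rw [h4, Pi.single_apply, Pi.single_apply]
      split_ifs <;> simp
    change red (Function.ExtendByZero.linearMap R (Fin.castLE hnm) (Pi.single i 1)) ∈ W at h2
    rwa [h3] at h2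
  have hli : LinearIndependent (ResidueField R) (fun i : Fin n =>
      (Pi.single (Fin.castLE hnm i) (1 : ResidueField R) : Fin m → ResidueField R)) := by
    have := (Pi.basisFun (ResidueField R) (Fin m)).linearIndependent.comp _
      (Fin.castLE_injective hnm)
    convert this using 1
    ext i
    simp
  have h5 := linearIndependent_le_span' _ hli _ hmem
  simp only [Cardinal.mk_fin, Finset.coe_sort_coe, Fintype.card_coe, Nat.cast_le] at h5
  have h6 := List.toFinset_card_le (f.map red)
  rw [List.length_map] at h6
  omega

theorem mem_lineU_iff {m : ℕ} {L : List (Submodule R (Fin m → R))} :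
    L ∈ (lineU R m).carrier ↔ ∃ v : List (Fin m → R), v ≠ [] ∧ ResidueIndependent R v ∧
      L = v.map (fun x => Submodule.span R {x}) := by
  constructor
  · rintro ⟨v, ⟨hv, hv'⟩, rfl⟩
    exact ⟨v, hv, hv'.residueIndependent, rfl⟩
  · rintro ⟨v, hv, hv', rfl⟩
    exact ⟨v, ⟨hv, hv'.isUnimodularSeq (Pi.basisFun R _)⟩, rfl⟩

/-- Covers the poset itself (`w = []`) and its links together. In the stated range `l ++ w` has
fewer than `n` entries, so one generic line of `R^n` can be prepended to all `l` in a finite set. -/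
theorem isAcyclic_of_carrier_eq [Infinite (ResidueField R)] {n m : ℕ} (hnm : n ≤ m)
    (w : List (Submodule R (Fin m → R))) (X : FramePoset (Submodule R (Fin m → R)))
    (hX : X.carrier = {v | v ≠ [] ∧ v ++ w ∈ (lineU R m).carrier ∧
      ∀ x ∈ v, x ∈ projSpaceIn R hnm}) :
    X.IsAcyclic ((n : ℤ) - w.length - 2) := by
  refine FramePoset.isAcyclic_of_exactAt _ _ fun ℓ hℓ hℓ' =>
    FramePoset.exactAt_of_cone fun t ht htC => ?_
  have hmem : ∀ l ∈ t, l ∈ X.carrier := fun l hl => by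
    obtain ⟨h | h, h'⟩ := htC l hl
    · simp [h] at h'
      omega
    · exact h
  rw [hX] at hmem
  have hlift : ∀ l, ∃ f : List (Fin m → R), l ∈ t → ResidueIndependent R f ∧
      l ++ w = f.map (fun x => Submodule.span R {x}) := by
    intro l
    by_cases hl : l ∈ t
    · obtain ⟨f, -, hf, hlf⟩ := mem_lineU_iff.1 (hmem l hl).2.1
      exact ⟨f, fun _ => ⟨hf, hlf⟩⟩
    · exact ⟨[], fun h => absurd h hl⟩
  choose f hf using hlift
  obtain ⟨v, hv⟩ := Submodule.exists_forall_notMem_of_ne_top t (fun l =>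
    (Submodule.span R {x | x ∈ f l} ⊔ maximalIdeal R • (⊤ : Submodule R (Fin m → R))).comap
      (Function.ExtendByZero.linearMap R (Fin.castLE hnm))) fun l hl => by
    refine comap_span_sup_ne_top hnm ?_
    have h := congrArg List.length (hf l hl).2
    rw [List.length_append, List.length_map, (htC l hl).2] at h
    omega
  set x := Function.ExtendByZero.linearMap R (Fin.castLE hnm) v with hx
  have hxP : Submodule.span R {x} ∈ projSpaceIn R hnm := by
    refine ⟨Submodule.span R {v}, ⟨v, ?_, rfl⟩, ?_⟩
    · refine ResidueIndependent.isUnimodularSeq (Pi.basisFun R _)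
        (ResidueIndependent.singleton_iff.2 fun h => ?_)
      obtain ⟨l, hl⟩ := ht
      exact hv l hl (Submodule.mem_sup_right (LinearMap.apply_mem_maximalIdeal_smul_top _ h))
    · rw [Submodule.map_span, Set.image_singleton]
  refine ⟨Submodule.span R {x}, fun l hl => Or.inr ?_⟩
  rw [hX]
  refine ⟨by simp, ?_, List.forall_mem_cons.2 ⟨hxP, (hmem l hl).2.2⟩⟩
  rw [mem_lineU_iff]
  exact ⟨x :: f l, by simp, ⟨hv l hl, (hf l hl).1⟩, by rw [List.cons_append, (hf l hl).2]; rfl⟩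

end Lines

/-! ### Isotropic frames in hyperbolic spaces -/

section Coordinates

open IsLocalRing

variable {R : Type*} [CommRing R] [IsLocalRing R] {ι : Type*}

theorem fst_apply_mem_maximalIdeal {f : (ι → R) × (ι → R)}
    (hf : f ∈ maximalIdeal R • (⊤ : Submodule R ((ι → R) × (ι → R)))) (i : ι) :
    f.1 i ∈ maximalIdeal R :=
  LinearMap.apply_mem_maximalIdeal (LinearMap.proj i ∘ₗ LinearMap.fst R (ι → R) (ι → R)) hf

theorem snd_apply_mem_maximalIdeal {f : (ι → R) × (ι → R)}
    (hf : f ∈ maximalIdeal R • (⊤ : Submodule R ((ι → R) × (ι → R)))) (i : ι) :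
    f.2 i ∈ maximalIdeal R :=
  LinearMap.apply_mem_maximalIdeal (LinearMap.proj i ∘ₗ LinearMap.snd R (ι → R) (ι → R)) hf

variable [Fintype ι]

theorem exists_isUnit_of_notMem {f : (ι → R) × (ι → R)}
    (hf : f ∉ maximalIdeal R • (⊤ : Submodule R ((ι → R) × (ι → R)))) :
    (∃ i, IsUnit (f.1 i)) ∨ ∃ i, IsUnit (f.2 i) := by
  classical
  by_contra! h
  refine hf (((Pi.basisFun R ι).prod (Pi.basisFun R ι)).mem_maximalIdeal_smul_top ?_)
  rintro (i | i)
  · simpa using h.1 i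
  · simpa using h.2 i

theorem mem_maximalIdeal_smul_top_of_forall {f : (ι → R) × (ι → R)}
    (h1 : ∀ i, f.1 i ∈ maximalIdeal R) (h2 : ∀ i, f.2 i ∈ maximalIdeal R) :
    f ∈ maximalIdeal R • (⊤ : Submodule R ((ι → R) × (ι → R))) := by
  by_contra hf
  rcases exists_isUnit_of_notMem hf with ⟨i, hi⟩ | ⟨i, hi⟩
  · exact notMem_maximalIdeal.2 hi (h1 i)
  · exact notMem_maximalIdeal.2 hi (h2 i)

end Coordinates

/-! ### The hyperbolic form, isotropic frames and reductions -/

section HyperbolicSpace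

open IsLocalRing

variable {R : Type*} [CommRing R] [StarRing R] {ι ι' : Type*} [Fintype ι] [Fintype ι']

/-- The hyperbolic form on `R^ι × R^ι`, linear in the second variable. -/
def sesqForm (ε : R) (x : (ι → R) × (ι → R)) : ((ι → R) × (ι → R)) →ₗ[R] R :=
  ∑ i, (star (x.1 i) • LinearMap.proj i ∘ₗ LinearMap.snd R _ _ +
    (ε * star (x.2 i)) • LinearMap.proj i ∘ₗ LinearMap.fst R _ _)

theorem sesqForm_apply (ε : R) (x y : (ι → R) × (ι → R)) :
    sesqForm ε x y = ∑ i, (star (x.1 i) * y.2 i + ε * (star (x.2 i) * y.1 i)) := by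
  simp [sesqForm, mul_assoc]

/-- The representative `∑ x̄_i x'_i` of the hyperbolic quadratic form at `(x, x')`. -/
def quadValue (x : (ι → R) × (ι → R)) : R := ∑ i, star (x.1 i) * x.2 i

theorem quadValue_smul (c : R) (x : (ι → R) × (ι → R)) :
    quadValue (c • x) = star c * quadValue x * c := by
  simp only [quadValue, Finset.mul_sum, Finset.sum_mul]
  refine Finset.sum_congr rfl fun i _ => ?_
  simp only [Prod.smul_fst, Prod.smul_snd, Pi.smul_apply, smul_eq_mul, star_mul']
  ring

theorem sesqForm_smul_left (ε c : R) (x y : (ι → R) × (ι → R)) :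
    sesqForm ε (c • x) y = star c * sesqForm ε x y := by
  simp only [sesqForm_apply, Finset.mul_sum]
  refine Finset.sum_congr rfl fun i _ => ?_
  simp only [Prod.smul_fst, Prod.smul_snd, Pi.smul_apply, smul_eq_mul, star_mul']
  ring

variable {ε : R} {Λ : AddSubgroup R}

theorem sesqForm_swap (hε : ε * star ε = 1) (x y : (ι → R) × (ι → R)) :
    sesqForm ε y x = ε * star (sesqForm ε x y) := by
  simp only [sesqForm_apply, star_sum, Finset.mul_sum]
  refine Finset.sum_congr rfl fun i _ => ?_
  simp only [star_add, star_mul', star_star]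
  linear_combination (-(x.2 i * star (y.1 i))) * hε

theorem sesqForm_eq_zero_comm (hε : ε * star ε = 1) {x y : (ι → R) × (ι → R)}
    (h : sesqForm ε x y = 0) : sesqForm ε y x = 0 := by
  rw [sesqForm_swap hε, h, star_zero, mul_zero]

/-- The defect is `r - ε * star r` for `r = ∑ i, star (y.1 i) * x.2 i`. -/
theorem quadValue_add (hΛ : IsFormParameter ε Λ) (x y : (ι → R) × (ι → R)) :
    quadValue (x + y) - quadValue x - quadValue y - sesqForm ε x y ∈ Λ := by
  convert hΛ.sub_mem (∑ i, star (y.1 i) * x.2 i) using 1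
  simp only [quadValue, sesqForm_apply, star_sum, Finset.mul_sum, ← Finset.sum_sub_distrib]
  refine Finset.sum_congr rfl fun i _ => ?_
  simp only [Prod.fst_add, Prod.snd_add, Pi.add_apply, star_add, star_mul', star_star]
  ring

theorem quadValue_smul_mem (hΛ : IsFormParameter ε Λ) (c : R) {x : (ι → R) × (ι → R)}
    (hx : quadValue x ∈ Λ) : quadValue (c • x) ∈ Λ := by
  rw [quadValue_smul]
  exact hΛ.conj_mem c _ hx

/-- Here the upper bound on `Λ` enters: `h(x, x) = q + ε q̄`, which vanishes for `q` in `Λ`. -/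
theorem sesqForm_self (hΛ : IsFormParameter ε Λ) {x : (ι → R) × (ι → R)}
    (hx : quadValue x ∈ Λ) : sesqForm ε x x = 0 := by
  have : sesqForm ε x x = quadValue x + ε * star (quadValue x) := by
    simp only [quadValue, sesqForm_apply, star_sum, Finset.mul_sum, ← Finset.sum_add_distrib]
    refine Finset.sum_congr rfl fun i _ => ?_
    simp only [star_mul', star_star]
    ring
  rw [this, hΛ.eq_neg _ hx, add_neg_cancel]

theorem quadValue_sub_smul_mem_iff (hε : ε * star ε = 1) (hΛ : IsFormParameter ε Λ)
    {f x : (ι → R) × (ι → R)} (hf : quadValue f ∈ Λ) (hfx : sesqForm ε f x = 0) (c : R) :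
    quadValue (x - c • f) ∈ Λ ↔ quadValue x ∈ Λ := by
  have h := quadValue_add hΛ x (-c • f)
  rw [map_smul, sesqForm_eq_zero_comm hε hfx, smul_zero, sub_zero, neg_smul,
    ← sub_eq_add_neg] at h
  have h1 : quadValue (-(c • f)) ∈ Λ := by
    rw [← neg_smul]
    exact quadValue_smul_mem hΛ _ hf
  constructor
  · intro h2
    have := Λ.sub_mem h2 (Λ.add_mem h h1)
    convert this using 1
    ring
  · intro h2
    have := Λ.add_mem (Λ.add_mem h h1) h2
    convert this using 1
    ring

/-- The isometry exchanging the two Lagrangians. -/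
def hyperbolicSwap (hε : ε * star ε = 1) : ((ι → R) × (ι → R)) ≃ₗ[R] ((ι → R) × (ι → R)) where
  toFun x := (x.2, ε • x.1)
  invFun x := (star ε • x.2, x.1)
  map_add' x y := by simp
  map_smul' c x := Prod.ext rfl (smul_comm ε c x.1)
  left_inv x := by simp [smul_smul, mul_comm (star ε), hε]
  right_inv x := by simp [smul_smul, hε]

theorem sesqForm_hyperbolicSwap (hε : ε * star ε = 1) (x y : (ι → R) × (ι → R)) :
    sesqForm ε (hyperbolicSwap hε x) (hyperbolicSwap hε y) = sesqForm ε x y := by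
  simp only [sesqForm_apply]
  refine Finset.sum_congr rfl fun i _ => ?_
  simp only [hyperbolicSwap, LinearEquiv.coe_mk, LinearMap.coe_mk, AddHom.coe_mk, Pi.smul_apply,
    smul_eq_mul, star_mul']
  linear_combination (star (x.1 i) * y.2 i) * hε

theorem quadValue_hyperbolicSwap_mem_iff (hε : ε * star ε = 1) (hΛ : IsFormParameter ε Λ)
    (x : (ι → R) × (ι → R)) : quadValue (hyperbolicSwap hε x) ∈ Λ ↔ quadValue x ∈ Λ := by
  have h : quadValue (hyperbolicSwap hε x) = ε * star (quadValue x) := by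
    simp only [quadValue, star_sum, Finset.mul_sum]
    refine Finset.sum_congr rfl fun i _ => ?_
    simp only [hyperbolicSwap, LinearEquiv.coe_mk, LinearMap.coe_mk, AddHom.coe_mk, Pi.smul_apply,
      smul_eq_mul, star_mul', star_star]
    ring
  have h' := hΛ.sub_mem (quadValue x)
  rw [← h] at h'
  exact ⟨fun h1 => by simpa using Λ.add_mem h' h1, fun h1 => by simpa using Λ.sub_mem h1 h'⟩

variable [IsLocalRing R]

variable (ε Λ) in
/-- A basis of an isotropic direct summand of `R^ι × R^ι`. -/
structure IsIsotropicFrame (l : List ((ι → R) × (ι → R))) : Prop where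
  isotropic : ∀ x ∈ l, quadValue x ∈ Λ
  orthogonal : ∀ x ∈ l, ∀ y ∈ l, sesqForm ε x y = 0
  independent : ResidueIndependent R l

theorem IsIsotropicFrame.sublist {u v : List ((ι → R) × (ι → R))} (huv : u.Sublist v)
    (hv : IsIsotropicFrame ε Λ v) : IsIsotropicFrame ε Λ u :=
  ⟨fun x hx => hv.isotropic x (huv.subset hx),
    fun x hx y hy => hv.orthogonal x (huv.subset hx) y (huv.subset hy), hv.independent.sublist huv⟩

theorem IsIsotropicFrame.perm {u v : List ((ι → R) × (ι → R))} (huv : u.Perm v)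
    (hu : IsIsotropicFrame ε Λ u) : IsIsotropicFrame ε Λ v :=
  ⟨fun x hx => hu.isotropic x (huv.mem_iff.2 hx),
    fun x hx y hy => hu.orthogonal x (huv.mem_iff.2 hx) y (huv.mem_iff.2 hy),
    hu.independent.perm huv⟩

theorem isIsotropicFrame_singleton (hΛ : IsFormParameter ε Λ) {x : (ι → R) × (ι → R)}
    (hx : quadValue x ∈ Λ) (hx' : x ∉ maximalIdeal R • (⊤ : Submodule R ((ι → R) × (ι → R)))) :
    IsIsotropicFrame ε Λ [x] := by
  refine ⟨by simpa using hx, ?_, ResidueIndependent.singleton_iff.2 hx'⟩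
  simpa using sesqForm_self hΛ hx

/-- Independence of `b` comes from the functional `sesqForm ε f`, which kills `l` and is a unit at
`b`. -/
theorem IsIsotropicFrame.append_singleton (hε : ε * star ε = 1) (hΛ : IsFormParameter ε Λ)
    {l : List ((ι → R) × (ι → R))} (hl : IsIsotropicFrame ε Λ l) {b f : (ι → R) × (ι → R)}
    (hb : quadValue b ∈ Λ) (hbl : ∀ x ∈ l, sesqForm ε b x = 0) (hfb : IsUnit (sesqForm ε f b))
    (hfl : ∀ x ∈ l, sesqForm ε f x = 0) : IsIsotropicFrame ε Λ (l ++ [b]) := by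
  refine IsIsotropicFrame.perm (u := b :: l) (List.perm_append_singleton b l).symm ⟨?_, ?_, ?_, hl.3⟩
  · exact List.forall_mem_cons.2 ⟨hb, hl.1⟩
  · simp only [List.forall_mem_cons]
    exact ⟨⟨sesqForm_self hΛ hb, hbl⟩, fun x hx =>
      ⟨sesqForm_eq_zero_comm hε (hbl x hx), hl.2 x hx⟩⟩
  · intro h
    have hle : Submodule.span R {y | y ∈ l} ⊔ maximalIdeal R • ⊤ ≤
        Submodule.comap (sesqForm ε f) (maximalIdeal R) := by
      refine sup_le (Submodule.span_le.2 fun x hx => ?_) fun x hx =>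
        LinearMap.apply_mem_maximalIdeal _ hx
      change sesqForm ε f x ∈ maximalIdeal R
      rw [hfl x hx]
      exact Ideal.zero_mem _
    exact notMem_maximalIdeal.2 hfb (hle h)

variable (ε Λ) in
/-- `ρ` induces an isometry of `F^⊥ / ⟨F⟩` with the hyperbolic space on `ι'`. -/
structure IsReduction (F : List ((ι → R) × (ι → R)))
    (ρ : ((ι → R) × (ι → R)) →ₗ[R] ((ι' → R) × (ι' → R))) : Prop where
  form : ∀ x y, (∀ f ∈ F, sesqForm ε f x = 0) → (∀ f ∈ F, sesqForm ε f y = 0) →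
    sesqForm ε (ρ x) (ρ y) = sesqForm ε x y
  quad : ∀ x, (∀ f ∈ F, sesqForm ε f x = 0) → (quadValue (ρ x) ∈ Λ ↔ quadValue x ∈ Λ)
  map_eq_zero : ∀ f ∈ F, ρ f = 0
  surjective : ∀ y, ∃ x, (∀ f ∈ F, sesqForm ε f x = 0) ∧ ρ x = y
  ker : ∀ x, (∀ f ∈ F, sesqForm ε f x = 0) →
    ρ x ∈ maximalIdeal R • (⊤ : Submodule R ((ι' → R) × (ι' → R))) →
    x ∈ Submodule.span R {f | f ∈ F} ⊔ maximalIdeal R • (⊤ : Submodule R ((ι → R) × (ι → R)))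

/-- Identifies the link of `F` with frames in the smaller hyperbolic space; this drives the
induction on rank. -/
theorem IsReduction.append_iff (hε : ε * star ε = 1) {F : List ((ι → R) × (ι → R))}
    {ρ : ((ι → R) × (ι → R)) →ₗ[R] ((ι' → R) × (ι' → R))} (hρ : IsReduction ε Λ F ρ)
    (hF : IsIsotropicFrame ε Λ F) {G : List ((ι → R) × (ι → R))}
    (hG : ∀ g ∈ G, ∀ f ∈ F, sesqForm ε f g = 0) :
    IsIsotropicFrame ε Λ (G ++ F) ↔ IsIsotropicFrame ε Λ (G.map ρ) := by
  have hind : ResidueIndependent R (G ++ F) ↔ ResidueIndependent R (G.map ρ) := by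
    refine ResidueIndependent.append_iff_map ρ (⨅ f ∈ F, LinearMap.ker (sesqForm ε f)) hF.3
      hρ.map_eq_zero (fun x hx => hρ.ker x (by simpa using hx)) fun g hg => ?_
    simpa using hG g hg
  constructor
  · intro h
    refine ⟨?_, ?_, hind.1 h.3⟩
    · simp only [List.forall_mem_map]
      exact fun g hg => (hρ.quad g (hG g hg)).2 (h.1 g (List.mem_append_left _ hg))
    · simp only [List.forall_mem_map]
      intro g hg g' hg'
      rw [hρ.form _ _ (hG g hg) (hG g' hg')]
      exact h.2 g (List.mem_append_left _ hg) g' (List.mem_append_left _ hg')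
  · intro h
    have h1 := h.1
    have h2 := h.2
    simp only [List.forall_mem_map] at h1 h2
    refine ⟨?_, ?_, hind.2 h.3⟩
    · exact List.forall_mem_append.2 ⟨fun g hg => (hρ.quad g (hG g hg)).1 (h1 g hg), hF.1⟩
    · simp only [List.forall_mem_append]
      refine ⟨fun g hg => ⟨fun g' hg' => ?_, fun f hf => sesqForm_eq_zero_comm hε (hG g hg f hf)⟩,
        fun f hf => ⟨fun g hg => hG g hg f hf, hF.2 f hf⟩⟩
      rw [← hρ.form _ _ (hG g hg) (hG g' hg')]
      exact h2 g hg g' hg'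

end HyperbolicSpace

/-! ### Existence of reductions, and general position for isotropic vectors -/

section HyperbolicSpace

open IsLocalRing

variable {R : Type*} [CommRing R] [StarRing R] [IsLocalRing R] {ι : Type} {ι' : Type}
  [Fintype ι] [Fintype ι'] {ε : R} {Λ : AddSubgroup R}

/-- Subtract the multiple of `f` that kills the `i`-th first coordinate, then forget the `i`-th
hyperbolic plane. The remaining `i`-th second coordinate is invisible to the forms, as its partner
is zero. -/
theorem exists_isReduction_of_isUnit_fst (hε : ε * star ε = 1) (hΛ : IsFormParameter ε Λ)
    [DecidableEq ι] {f : (ι → R) × (ι → R)} (hf : quadValue f ∈ Λ) {i : ι} (hi : IsUnit (f.1 i)) :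
    ∃ ρ : ((ι → R) × (ι → R)) →ₗ[R] (({j // j ≠ i} → R) × ({j // j ≠ i} → R)),
      IsReduction ε Λ [f] ρ := by
  obtain ⟨u, hu⟩ := hi
  set c : ((ι → R) × (ι → R)) →ₗ[R] R :=
    (↑u⁻¹ : R) • (LinearMap.proj i ∘ₗ LinearMap.fst R (ι → R) (ι → R)) with hc
  have hcx : ∀ x, c x * f.1 i = x.1 i := fun x => by
    rw [← hu, hc]
    simp [mul_comm]
  set res : (ι → R) →ₗ[R] ({j // j ≠ i} → R) := LinearMap.funLeft R R Subtype.val with hres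
  set ρ := res.prodMap res ∘ₗ (LinearMap.id - c.smulRight f) with hρ
  have hρ1 : ∀ x (j : {j // j ≠ i}), (ρ x).1 j = (x - c x • f).1 j := fun x j => rfl
  have hρ2 : ∀ x (j : {j // j ≠ i}), (ρ x).2 j = (x - c x • f).2 j := fun x j => rfl
  have hxi : ∀ x, (x - c x • f).1 i = 0 := fun x => by
    simp [hcx]
  have hself := sesqForm_self hΛ hf
  refine ⟨ρ, ?_, ?_, ?_, ?_, ?_⟩
  · intro x y hx hy
    have hfx : sesqForm ε f x = 0 := hx f (by simp)
    have hfy : sesqForm ε f y = 0 := hy f (by simp)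
    have h1 : sesqForm ε (x - c x • f) (y - c y • f) = sesqForm ε x y := by
      have h2 : sesqForm ε (y - c y • f) (x - c x • f) = sesqForm ε (y - c y • f) x := by
        rw [map_sub, map_smul, sesqForm_eq_zero_comm hε (x := f), smul_zero, sub_zero]
        rw [map_sub, map_smul, hfy, hself, smul_zero, sub_zero]
      rw [sesqForm_swap hε, h2, ← sesqForm_swap hε, map_sub, map_smul,
        sesqForm_eq_zero_comm hε hfx, smul_zero, sub_zero]
    rw [← h1, sesqForm_apply, sesqForm_apply, Fintype.sum_eq_add_sum_subtype_ne _ i, hxi, hxi]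
    simp [hρ1, hρ2]
  · intro x hx
    rw [← quadValue_sub_smul_mem_iff hε hΛ hf (hx f (by simp)) (c x)]
    have : quadValue (ρ x) = quadValue (x - c x • f) := by
      rw [quadValue, quadValue, Fintype.sum_eq_add_sum_subtype_ne _ i, hxi]
      simp [hρ1, hρ2]
    rw [this]
  · simp only [List.mem_singleton, forall_eq]
    have : c f = 1 := by simp [hc, ← hu]
    simp [hρ, this]
  · intro y
    set z : (ι → R) × (ι → R) := (fun j => if h : j ≠ i then y.1 ⟨j, h⟩ else 0,
      fun j => if h : j ≠ i then y.2 ⟨j, h⟩ else 0) with hz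
    -- The correction in the forgotten coordinate that makes the extension by zero orthogonal to
    -- `f`.
    set a := star (↑u⁻¹ : R) * sesqForm ε f z with ha
    have hau : star (f.1 i) * a = sesqForm ε f z := by
      rw [ha, ← mul_assoc, ← star_mul', ← hu]
      simp
    have hs : sesqForm ε f (0, Pi.single i a) = star (f.1 i) * a := by
      simp [sesqForm_apply, Pi.single_apply]
    refine ⟨z - (0, Pi.single i a), ?_, ?_⟩
    · simp only [List.mem_singleton, forall_eq]
      rw [map_sub, hs, hau, sub_self]
    · have hc0 : c (z - (0, Pi.single i a)) = 0 := by simp [hc, hz]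
      ext j
      · rw [hρ1, hc0]
        simp [hz, j.2]
      · rw [hρ2, hc0]
        simp [hz, j.2]
  · intro x hx hm
    have hfx : sesqForm ε f x = 0 := hx f (by simp)
    have h0 : sesqForm ε f (x - c x • f) = 0 := by
      rw [map_sub, map_smul, hfx, hself, smul_zero, sub_zero]
    have h1 : ∀ j, (x - c x • f).1 j ∈ maximalIdeal R := fun j => by
      by_cases hj : j = i
      · rw [hj, hxi]
        exact Ideal.zero_mem _
      · exact fst_apply_mem_maximalIdeal hm ⟨j, hj⟩
    have h2 : ∀ j, j ≠ i → (x - c x • f).2 j ∈ maximalIdeal R := fun j hj =>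
      snd_apply_mem_maximalIdeal hm ⟨j, hj⟩
    -- The one coordinate that `ρ` does not see is controlled by orthogonality to `f`, where it
    -- occurs with the unit coefficient `star (f.1 i)`.
    have h3 : (x - c x • f).2 i ∈ maximalIdeal R := by
      rw [sesqForm_apply, Fintype.sum_eq_add_sum_subtype_ne _ i, hxi, mul_zero, mul_zero,
        add_zero] at h0
      have hunit : IsUnit (star (f.1 i)) := by
        rw [← hu]
        exact u.isUnit.star
      refine (Submodule.smul_mem_iff_of_isUnit (maximalIdeal R) hunit).1 ?_
      rw [smul_eq_mul, eq_neg_of_add_eq_zero_left h0]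
      refine neg_mem (Ideal.sum_mem _ fun j _ => Ideal.add_mem _ ?_ ?_)
      · exact Ideal.mul_mem_left _ _ (h2 j j.2)
      · exact Ideal.mul_mem_left _ _ (Ideal.mul_mem_left _ _ (h1 j))
    have h4 : x - c x • f ∈ maximalIdeal R • (⊤ : Submodule R ((ι → R) × (ι → R))) := by
      refine mem_maximalIdeal_smul_top_of_forall h1 fun j => ?_
      by_cases hj : j = i
      · rwa [hj]
      · exact h2 j hj
    rw [← add_sub_cancel (c x • f) x]
    exact Submodule.add_mem_sup
      (Submodule.smul_mem _ _ (Submodule.subset_span (by simp))) h4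

theorem IsReduction.comp_equiv (σ : ((ι → R) × (ι → R)) ≃ₗ[R] ((ι → R) × (ι → R)))
    (hσ : ∀ x y, sesqForm ε (σ x) (σ y) = sesqForm ε x y)
    (hσ' : ∀ x, quadValue (σ x) ∈ Λ ↔ quadValue x ∈ Λ) {f : (ι → R) × (ι → R)}
    {ρ : ((ι → R) × (ι → R)) →ₗ[R] ((ι' → R) × (ι' → R))} (hρ : IsReduction ε Λ [σ f] ρ) :
    IsReduction ε Λ [f] (ρ ∘ₗ σ.toLinearMap) := by
  obtain ⟨h1, h2, h3, h4, h5⟩ := hρ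
  simp only [List.mem_singleton, forall_eq] at h1 h2 h3 h4 h5
  refine ⟨?_, ?_, ?_, ?_, ?_⟩ <;> simp only [List.mem_singleton, forall_eq, LinearMap.comp_apply,
    LinearEquiv.coe_coe]
  · intro x y hx hy
    rw [h1 _ _ (by rwa [hσ]) (by rwa [hσ]), hσ]
  · intro x hx
    rw [h2 _ (by rwa [hσ]), hσ']
  · exact h3
  · intro y
    obtain ⟨x, hx, hxy⟩ := h4 y
    exact ⟨σ.symm x, by rw [← hσ, σ.apply_symm_apply, hx], by rwa [σ.apply_symm_apply]⟩
  · intro x hx hm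
    obtain ⟨a, ha, e, he, hae⟩ := Submodule.mem_sup.1 (h5 _ (by rwa [hσ]) hm)
    simp only [Set.ofPred_eq_eq_singleton] at ha ⊢
    obtain ⟨r, rfl⟩ := Submodule.mem_span_singleton.1 ha
    have hx' : x = r • f + σ.symm e := by
      rw [← σ.symm_apply_apply x, ← hae, map_add, map_smul, σ.symm_apply_apply]
    rw [hx']
    exact Submodule.add_mem_sup (Submodule.smul_mem _ _ (Submodule.mem_span_singleton_self f))
      (LinearMap.apply_mem_maximalIdeal_smul_top σ.symm.toLinearMap he)

/-- If the unit coordinate of `f` lies in the second half, the two Lagrangians are exchanged first.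
-/
theorem exists_isReduction_singleton (hε : ε * star ε = 1) (hΛ : IsFormParameter ε Λ)
    {f : (ι → R) × (ι → R)} (hf : quadValue f ∈ Λ)
    (hf' : f ∉ maximalIdeal R • (⊤ : Submodule R ((ι → R) × (ι → R)))) :
    ∃ (κ : Type) (_ : Fintype κ) (ρ : ((ι → R) × (ι → R)) →ₗ[R] ((κ → R) × (κ → R))),
      Fintype.card κ + 1 = Fintype.card ι ∧ IsReduction ε Λ [f] ρ := by
  classical
  have hcard : ∀ i : ι, Fintype.card {j // j ≠ i} + 1 = Fintype.card ι := fun i => by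
    have := Fintype.card_pos_iff.2 ⟨i⟩
    rw [Fintype.card_subtype_compl, Fintype.card_subtype_eq]
    omega
  rcases exists_isUnit_of_notMem hf' with ⟨i, hi⟩ | ⟨i, hi⟩
  · obtain ⟨ρ, hρ⟩ := exists_isReduction_of_isUnit_fst hε hΛ hf hi
    exact ⟨_, inferInstance, ρ, hcard i, hρ⟩
  · obtain ⟨ρ, hρ⟩ := exists_isReduction_of_isUnit_fst hε hΛ
      ((quadValue_hyperbolicSwap_mem_iff hε hΛ f).2 hf) (i := i) hi
    exact ⟨_, inferInstance, _, hcard i, hρ.comp_equiv _ (sesqForm_hyperbolicSwap hε)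
      (quadValue_hyperbolicSwap_mem_iff hε hΛ)⟩

/-- Reduction in stages: first by `f`, then by the image of `F` in `f^⊥/⟨f⟩`. -/
theorem IsReduction.comp {κ : Type} [Fintype κ] {f : (ι → R) × (ι → R)}
    {F : List ((ι → R) × (ι → R))} (hfF : ∀ g ∈ F, sesqForm ε f g = 0)
    {ρ : ((ι → R) × (ι → R)) →ₗ[R] ((ι' → R) × (ι' → R))} (hρ : IsReduction ε Λ [f] ρ)
    {τ : ((ι' → R) × (ι' → R)) →ₗ[R] ((κ → R) × (κ → R))} (hτ : IsReduction ε Λ (F.map ρ) τ) :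
    IsReduction ε Λ (f :: F) (τ ∘ₗ ρ) := by
  obtain ⟨h1, h2, h3, h4, h5⟩ := hρ
  simp only [List.mem_singleton, forall_eq] at h1 h2 h3 h4 h5
  obtain ⟨k1, k2, k3, k4, k5⟩ := hτ
  simp only [List.forall_mem_map] at k1 k2 k3 k4 k5
  have hperp : ∀ x, sesqForm ε f x = 0 →
      ((∀ g ∈ F, sesqForm ε (ρ g) (ρ x) = 0) ↔ ∀ g ∈ F, sesqForm ε g x = 0) := fun x hx =>
    forall₂_congr fun g hg => by rw [h1 g x (hfF g hg) hx]
  refine ⟨?_, ?_, ?_, ?_, ?_⟩ <;> simp only [List.forall_mem_cons, LinearMap.comp_apply]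
  · rintro x y ⟨hx, hx'⟩ ⟨hy, hy'⟩
    rw [k1 _ _ ((hperp x hx).2 hx') ((hperp y hy).2 hy'), h1 x y hx hy]
  · rintro x ⟨hx, hx'⟩
    rw [k2 _ ((hperp x hx).2 hx'), h2 x hx]
  · exact ⟨by rw [h3, map_zero], k3⟩
  · intro z
    obtain ⟨y, hy, rfl⟩ := k4 z
    obtain ⟨x, hx, rfl⟩ := h4 y
    exact ⟨x, ⟨hx, (hperp x hx).1 hy⟩, rfl⟩
  · rintro x ⟨hx, hx'⟩ hm
    have h := k5 _ ((hperp x hx).2 hx') hm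
    have hset : {g | g ∈ F.map ρ} = ρ '' {g | g ∈ F} := by ext; simp
    rw [hset, Submodule.span_image] at h
    obtain ⟨_, ⟨a, ha, rfl⟩, e, he, hae⟩ := Submodule.mem_sup.1 h
    have hfa : sesqForm ε f a = 0 :=
      (Submodule.span_le.2 hfF : Submodule.span R {g | g ∈ F} ≤ LinearMap.ker (sesqForm ε f)) ha
    have h' := h5 (x - a) (by rw [map_sub, hx, hfa, sub_zero])
      (by rwa [map_sub, ← hae, add_sub_cancel_left])
    simp only [Set.ofPred_eq_eq_singleton] at h'
    rw [List.span_cons, sup_comm (Submodule.span R {f}), sup_assoc, ← add_sub_cancel a x]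
    exact Submodule.add_mem_sup ha h'

theorem isReduction_nil : IsReduction ε Λ ([] : List ((ι → R) × (ι → R))) LinearMap.id :=
  ⟨fun _ _ _ _ => rfl, fun _ _ => Iff.rfl, by simp, fun y => ⟨y, by simp, rfl⟩,
    fun _ _ h => Submodule.mem_sup_right h⟩

theorem exists_isReduction (hε : ε * star ε = 1) (hΛ : IsFormParameter ε Λ) (n : ℕ) :
    ∀ (ι : Type) [Fintype ι] (F : List ((ι → R) × (ι → R))), F.length = n →
      IsIsotropicFrame ε Λ F →
      ∃ (κ : Type) (_ : Fintype κ) (ρ : ((ι → R) × (ι → R)) →ₗ[R] ((κ → R) × (κ → R))),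
        Fintype.card κ + n = Fintype.card ι ∧ IsReduction ε Λ F ρ := by
  induction n with
  | zero =>
    intro ι _ F hn _
    rw [List.length_eq_zero_iff.1 hn]
    exact ⟨ι, inferInstance, LinearMap.id, rfl, isReduction_nil⟩
  | succ n ih =>
    intro ι _ F hn hF
    obtain ⟨f, F, rfl⟩ := List.exists_cons_of_length_eq_add_one hn
    have hfF : ∀ g ∈ F, sesqForm ε f g = 0 := fun g hg =>
      hF.2 f (by simp) g (List.mem_cons_of_mem _ hg)
    obtain ⟨ι', _, ρ, hcard, hρ⟩ := exists_isReduction_singleton hε hΛ (hF.1 f (by simp))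
      (hF.3.notMem (x := f) (by simp))
    have hF' : IsIsotropicFrame ε Λ (F.map ρ) :=
      (hρ.append_iff hε (hF.sublist (by simp)) (by simpa using hfF)).1
        (hF.perm (List.perm_append_singleton f F).symm)
    obtain ⟨κ, _, τ, hcard', hτ⟩ := ih ι' (F.map ρ) (by simpa using hn) hF'
    exact ⟨κ, inferInstance, _, by omega, hρ.comp hfF hτ⟩

/-- General position: an isotropic vector that pairs to a unit with finitely many vectors. -/
theorem exists_isUnit_sesqForm [Infinite (ResidueField R)] (hε : ε * star ε = 1)
    (hι : 2 ≤ Fintype.card ι) (s : Finset ((ι → R) × (ι → R)))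
    (hs : ∀ f ∈ s, f ∉ maximalIdeal R • (⊤ : Submodule R ((ι → R) × (ι → R)))) :
    ∃ v : (ι → R) × (ι → R), quadValue v = 0 ∧ ∀ f ∈ s, IsUnit (sesqForm ε f v) := by
  classical
  have hεu : IsUnit ε := IsUnit.of_mul_eq_one _ hε
  -- The vector sought has the form `(a • x, y)` with `∑ x̄_j y_j = 0`, which makes it isotropic. A
  -- unit value of `ψ` at `x` ensures that some such `(a, y)` pairs to a unit with `f`.
  have key : ∀ f : (ι → R) × (ι → R), ∃ ψ : (ι → R) →ₗ[R] R, f ∈ s → (∃ x, IsUnit (ψ x)) ∧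
      ∀ x, IsUnit (ψ x) → ∃ (a : R) (y : ι → R), ∑ j, star (x j) * y j = 0 ∧
        IsUnit (sesqForm ε f (a • x, y)) := by
    intro f
    by_cases hf : f ∈ s
    swap
    · exact ⟨0, fun h => absurd h hf⟩
    rcases exists_isUnit_of_notMem (hs f hf) with ⟨i, hi⟩ | ⟨i, hi⟩
    · obtain ⟨k, hk⟩ := Fintype.exists_ne_of_one_lt_card (by omega) i
      -- A second index `k` makes room for `y = x̄_k e_i - x̄_i e_k`, which satisfies the isotropy
      -- condition and pairs with `f` to `star (ψ x)`.
      refine ⟨f.1 i • LinearMap.proj k - f.1 k • LinearMap.proj i, fun _ =>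
        ⟨⟨Pi.single k 1, by simpa [Pi.single_apply, hk.symm] using hi⟩, fun x hx =>
        ⟨0, Pi.single i (star (x k)) - Pi.single k (star (x i)), ?_, ?_⟩⟩⟩
      · simp [mul_sub, Finset.sum_sub_distrib, Pi.single_apply, mul_comm (star (x k))]
      · convert hx.star using 1
        simp [sesqForm_apply, mul_sub, Finset.sum_sub_distrib, Pi.single_apply]
    · refine ⟨∑ j, star (f.2 j) • LinearMap.proj j, fun _ =>
        ⟨⟨Pi.single i 1, by simpa [Pi.single_apply] using hi.star⟩, fun x hx =>
        ⟨1, 0, by simp, ?_⟩⟩⟩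
      convert hεu.mul hx using 1
      simp [sesqForm_apply, Finset.mul_sum]
  choose ψ hψ using key
  obtain ⟨x, hx⟩ := Submodule.exists_forall_notMem_of_ne_top s
    (fun f => Submodule.comap (ψ f) (maximalIdeal R)) fun f hf htop => by
      obtain ⟨x, hx⟩ := (hψ f hf).1
      have : x ∈ Submodule.comap (ψ f) (maximalIdeal R) := htop ▸ trivial
      exact notMem_maximalIdeal.2 hx this
  -- With `x` fixed the isotropy condition is linear in `(a, y)`, so general position applies once
  -- more, inside the kernel of `pair`.
  set pair : R × (ι → R) →ₗ[R] R :=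
    ∑ j, star (x j) • (LinearMap.proj j ∘ₗ LinearMap.snd R R (ι → R)) with hpair
  have hpair_apply : ∀ p, pair p = ∑ j, star (x j) * p.2 j := fun p => by simp [hpair]
  set emb : R × (ι → R) →ₗ[R] (ι → R) × (ι → R) :=
    (LinearMap.id.smulRight x).prodMap LinearMap.id with hemb
  have hemb_apply : ∀ p, emb p = (p.1 • x, p.2) := fun p => rfl
  obtain ⟨p, hp⟩ := Submodule.exists_forall_notMem_of_ne_top s
    (fun f => Submodule.comap (sesqForm ε f ∘ₗ emb ∘ₗ (LinearMap.ker pair).subtype)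
      (maximalIdeal R))
    fun f hf htop => by
      obtain ⟨a, y, hy, hay⟩ := (hψ f hf).2 x (notMem_maximalIdeal.1 (hx f hf))
      have hmem : (⟨(a, y), by rw [LinearMap.mem_ker, hpair_apply, hy]⟩ : LinearMap.ker pair) ∈
        Submodule.comap (sesqForm ε f ∘ₗ emb ∘ₗ (LinearMap.ker pair).subtype)
          (maximalIdeal R) :=
        htop ▸ trivial
      exact notMem_maximalIdeal.2 hay hmem
  refine ⟨emb p, ?_, fun f hf => notMem_maximalIdeal.1 (hp f hf)⟩
  have hp0 := p.2
  rw [LinearMap.mem_ker, hpair_apply] at hp0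
  simp only [quadValue, hemb_apply, Pi.smul_apply, smul_eq_mul, star_mul', mul_assoc,
    ← Finset.mul_sum, hp0, mul_zero]

end HyperbolicSpace

/-! ### Sphericity of the complex of isotropic frames -/

section HyperbolicSpace

open IsLocalRing FramePoset

variable {R : Type*} [CommRing R] [StarRing R] [IsLocalRing R] {ε : R} {Λ : AddSubgroup R}

/-- The sequences in `A` that `π` maps to isotropic frames form a spherical complex, provided that
`π` hits every unimodular vector up to a unit. -/
theorem exactAt_isIsotropicFrame [Infinite (ResidueField R)] (hε : ε * star ε = 1)
    (hΛ : IsFormParameter ε Λ) {S : Type*} (d : ℕ) :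
    ∀ (ι : Type) [Fintype ι] (A : Set S) (π : S → (ι → R) × (ι → R)), Fintype.card ι = d →
      (∀ v ∉ maximalIdeal R • (⊤ : Submodule R ((ι → R) × (ι → R))),
        ∃ a ∈ A, ∃ u : Rˣ, π a = (u : R) • v) →
      ∀ ℓ < d, ExactAt {G | (∀ g ∈ G, g ∈ A) ∧ IsIsotropicFrame ε Λ (G.map π)} ℓ := by
  classical
  induction d using Nat.strong_induction_on with
  | _ d ih =>
  intro ι _ A π hcard hπ ℓ hℓ
  rcases Nat.eq_zero_or_pos ℓ with rfl | hℓ0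
  · obtain ⟨i⟩ : Nonempty ι := Fintype.card_pos_iff.1 (by omega)
    set e : (ι → R) × (ι → R) := (Pi.single i 1, 0) with he
    have he' : e ∉ maximalIdeal R • (⊤ : Submodule R ((ι → R) × (ι → R))) := fun h =>
      notMem_maximalIdeal.2 (isUnit_one (M := R)) (by simpa [he] using fst_apply_mem_maximalIdeal h i)
    obtain ⟨a, ha, u, hau⟩ := hπ e he'
    refine exactAt_of_cone fun t _ ht => ⟨a, fun l hl => ?_⟩
    rw [List.length_eq_zero_iff.1 (ht l hl).2]
    refine ⟨by simpa using ha, isIsotropicFrame_singleton hΛ ?_ ?_⟩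
    · rw [hau]
      exact quadValue_smul_mem hΛ _ (by simp [quadValue, he])
    · rwa [hau, Submodule.smul_mem_iff_of_isUnit _ u.isUnit]
  intro z hz hz0
  rcases eq_or_ne z 0 with rfl | hne
  · exact ⟨0, Submodule.zero_mem _, by simp⟩
  set s : Finset ((ι → R) × (ι → R)) := z.support.biUnion fun L => (L.map π).toFinset with hs
  have hzC := mem_chains.1 hz
  have hsm : ∀ L ∈ z.support, ∀ g ∈ L, π g ∈ s := fun L hL g hg =>
    Finset.mem_biUnion.2 ⟨L, hL, by simpa using ⟨g, hg, rfl⟩⟩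
  obtain ⟨v, hv, hsv⟩ := exists_isUnit_sesqForm hε (ι := ι) (by omega) s fun f hf => by
    obtain ⟨L, hL, hfL⟩ := Finset.mem_biUnion.1 hf
    exact (hzC L hL).1.2.3.notMem (List.mem_toFinset.1 hfL)
  have hv' : v ∉ maximalIdeal R • (⊤ : Submodule R ((ι → R) × (ι → R))) := by
    obtain ⟨L, hL⟩ := Finsupp.support_nonempty_iff.2 hne
    obtain ⟨g, hg⟩ := List.exists_mem_of_length_pos (by rw [(hzC L hL).2]; exact hℓ0)
    exact fun h => notMem_maximalIdeal.2 (hsv _ (hsm L hL g hg))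
      (LinearMap.apply_mem_maximalIdeal _ h)
  obtain ⟨a, haA, u, hau⟩ := hπ v hv'
  have haq : quadValue (π a) ∈ Λ := by
    rw [hau]
    exact quadValue_smul_mem hΛ _ (by rw [hv]; exact Λ.zero_mem)
  have hunit : ∀ L ∈ z.support, ∀ g ∈ L, IsUnit (sesqForm ε (π g) (π a)) := fun L hL g hg => by
    rw [hau, map_smul]
    exact u.isUnit.mul (hsv _ (hsm L hL g hg))
  -- Tails are subsequences of the sequences in the cycle; `good` means orthogonal to `a`, which no
  -- entry of the cycle is.
  refine exists_deltaLin_eq (T := {F | ∃ L ∈ z.support, F.Sublist L}) (a := a) (d := d)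
    (good := {g | sesqForm ε (π g) (π a) = 0})
    (Y := fun F => {G | (∀ g ∈ G, g ∈ A) ∧ IsIsotropicFrame ε Λ ((G ++ F).map π) ∧
      IsIsotropicFrame ε Λ ((G ++ [a]).map π)})
    ?_ ?_ ?_ ?_ ?_ ?_ ?_ ?_ hℓ ?_ hz0
  · rintro F ⟨L, hL, hFL⟩ F' hF'
    exact ⟨L, hL, hF'.trans hFL⟩
  · rintro F ⟨L, hL, hFL⟩ g hg h0
    have := hunit L hL g (hFL.subset hg)
    rw [show sesqForm ε (π g) (π a) = 0 from h0] at this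
    exact not_isUnit_zero this
  · rintro F - G ⟨-, -, hG⟩ g hg
    exact hG.2 _ (List.mem_map_of_mem (by simp [hg])) _ (List.mem_map_of_mem (by simp))
  · rintro F - F' hF' G ⟨h1, h2, h3⟩
    exact ⟨h1, h2.sublist (((List.Sublist.refl G).append hF').map π), h3⟩
  · rintro F ⟨L, hL, hFL⟩ G ⟨h1, h2, -⟩
    exact ⟨List.forall_mem_append.2 ⟨h1, fun f hf => (hzC L hL).1.1 f (hFL.subset hf)⟩, h2⟩
  · rintro G ⟨h1, -, h3⟩
    exact ⟨List.forall_mem_append.2 ⟨h1, by simpa using haA⟩, h3⟩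
  · rintro F ⟨L, hL, hFL⟩ hFne k hk
    have hF : IsIsotropicFrame ε Λ (F.map π) := (hzC L hL).1.2.sublist (hFL.map π)
    obtain ⟨κ, _, ρ, hκ, hρ⟩ := exists_isReduction hε hΛ F.length ι (F.map π) (by simp) hF
    obtain ⟨f, hf⟩ := List.exists_mem_of_ne_nil F hFne
    have hfa := hunit L hL f (hFL.subset hf)
    have hlen : 0 < F.length := List.length_pos_of_mem hf
    -- The coefficients at `F` are frames in the reduction by `F`, with entries taken from the part
    -- of `A` orthogonal to `F` and `a`. That `a` extends such a `G` is automatic, since some `f` in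
    -- `F` is orthogonal to `G` but not to `a`.
    convert ih (d - F.length) (by omega) κ
      {g | g ∈ A ∧ (∀ x ∈ F.map π, sesqForm ε x (π g) = 0) ∧ sesqForm ε (π a) (π g) = 0}
      (fun g => ρ (π g)) (by omega) ?_ k (by omega) using 1
    · ext G
      have hmap : G.map (fun g => ρ (π g)) = (G.map π).map ρ := by simp
      rw [Set.mem_ofPred_eq, Set.mem_ofPred_eq, hmap, List.map_append]
      constructor
      · rintro ⟨h1, h2, h3⟩
        have h4 : ∀ g ∈ G, ∀ x ∈ F.map π, sesqForm ε x (π g) = 0 := fun g hg x hx =>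
          h2.2 x (List.mem_append_right _ hx) _ (List.mem_append_left _ (List.mem_map_of_mem hg))
        refine ⟨fun g hg => ⟨h1 g hg, h4 g hg, ?_⟩, (hρ.append_iff hε hF (by simpa using h4)).1 h2⟩
        exact h3.2 _ (List.mem_map_of_mem (by simp)) _ (List.mem_map_of_mem (by simp [hg]))
      · rintro ⟨h1, h2⟩
        have h3 := (hρ.append_iff hε hF (G := G.map π) (by
          simp only [List.forall_mem_map]
          exact fun g hg f' hf' => (h1 g hg).2.1 _ (List.mem_map_of_mem hf'))).2 h2
        refine ⟨fun g hg => (h1 g hg).1, h3, ?_⟩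
        rw [List.map_append]
        refine (h3.sublist (List.sublist_append_left _ _)).append_singleton hε hΛ (f := π f) haq
          ?_ hfa ?_
        · simpa using fun g hg => (h1 g hg).2.2
        · simpa using fun g hg => (h1 g hg).2.1 _ (List.mem_map_of_mem hf)
    · intro y hy
      obtain ⟨x, hx, rfl⟩ := hρ.surjective y
      have haf : IsUnit (sesqForm ε (π a) (π f)) := by
        rw [sesqForm_swap hε]
        exact (IsUnit.of_mul_eq_one _ hε).mul hfa.star
      obtain ⟨w, hw⟩ := haf
      -- Moving `x` along `π f` leaves its class modulo `⟨F⟩` unchanged and makes it orthogonal to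
      -- `a`.
      set c := (↑w⁻¹ : R) * sesqForm ε (π a) x with hc
      set x' := x - c • π f with hx'
      have hρx' : ρ x' = ρ x := by
        rw [hx', map_sub, map_smul, hρ.map_eq_zero _ (List.mem_map_of_mem hf), smul_zero, sub_zero]
      have hFx' : ∀ g ∈ F.map π, sesqForm ε g x' = 0 := fun g hg => by
        rw [hx', map_sub, map_smul, hx g hg, hF.2 g hg _ (List.mem_map_of_mem hf), smul_zero,
          sub_zero]
      have hax' : sesqForm ε (π a) x' = 0 := by
        rw [hx', map_sub, map_smul, ← hw, hc, smul_eq_mul, mul_right_comm, Units.inv_mul, one_mul,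
          sub_self]
      obtain ⟨b, hb, r, hbr⟩ := hπ x' fun h => hy (by
        rw [← hρx']
        exact ρ.apply_mem_maximalIdeal_smul_top h)
      refine ⟨b, ⟨hb, fun g hg => ?_, ?_⟩, r, ?_⟩
      · rw [hbr, map_smul, hFx' g hg, smul_zero]
      · rw [hbr, map_smul, hax', smul_zero]
      · rw [hbr, map_smul, hρx']
  · rintro F ⟨L, hL, hFL⟩
    refine ⟨by simp, (hzC L hL).1.2.sublist (hFL.map π), isIsotropicFrame_singleton hΛ haq ?_⟩
    rwa [hau, Submodule.smul_mem_iff_of_isUnit _ u.isUnit]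
  · exact mem_chains.2 fun L hL => ⟨⟨L, hL, List.Sublist.refl L⟩, (hzC L hL).2⟩

end HyperbolicSpace

/-! ### Frames of isotropic lines -/

section LineGenerators

open IsLocalRing

variable {R : Type*} [CommRing R] [IsLocalRing R] {M : Type*} [AddCommGroup M] [Module R M]

theorem ResidueIndependent.map_of_unit_smul {α : Type*} {l : List α} {f g : α → M}
    (h : ∀ a ∈ l, ∃ u : Rˣ, g a = (u : R) • f a) (hl : ResidueIndependent R (l.map f)) :
    ResidueIndependent R (l.map g) := by
  induction l with
  | nil => trivial
  | cons a l ih =>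
    rw [List.forall_mem_cons] at h
    refine ⟨fun hmem => hl.1 ?_, ih h.2 hl.2⟩
    obtain ⟨u, hu⟩ := h.1
    rw [hu, Submodule.smul_mem_iff_of_isUnit _ u.isUnit] at hmem
    have hle : Submodule.span R {y | y ∈ l.map g} ≤ Submodule.span R {y | y ∈ l.map f} := by
      refine Submodule.span_le.2 fun y hy => ?_
      obtain ⟨b, hb, rfl⟩ := List.mem_map.1 hy
      obtain ⟨w, hw⟩ := h.2 b hb
      rw [hw]
      exact Submodule.smul_mem _ _ (Submodule.subset_span (List.mem_map_of_mem hb))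
    exact sup_le_sup_right hle (maximalIdeal R • ⊤) hmem

open Classical in
/-- A generator of a line spanned by a unimodular vector. -/
noncomputable def lineGenerator (L : Submodule R M) : M :=
  if h : ∃ v : M, v ∉ maximalIdeal R • (⊤ : Submodule R M) ∧ L = Submodule.span R {v} then
    h.choose else 0

theorem lineGenerator_spec {L : Submodule R M}
    (h : ∃ v : M, v ∉ maximalIdeal R • (⊤ : Submodule R M) ∧ L = Submodule.span R {v}) :
    lineGenerator L ∉ maximalIdeal R • (⊤ : Submodule R M) ∧
      L = Submodule.span R {lineGenerator L} := by
  rw [lineGenerator, dif_pos h]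
  exact h.choose_spec

theorem exists_lineGenerator_eq_smul {v : M}
    (hv : v ∉ maximalIdeal R • (⊤ : Submodule R M)) :
    ∃ u : Rˣ, lineGenerator (Submodule.span R {v}) = (u : R) • v := by
  obtain ⟨h1, h2⟩ := lineGenerator_spec ⟨v, hv, rfl⟩
  have h3 : lineGenerator (Submodule.span R {v}) ∈ Submodule.span R {v} :=
    h2.symm.le (Submodule.mem_span_singleton_self (R := R) _)
  obtain ⟨c, hc⟩ := Submodule.mem_span_singleton.1 h3
  have hcu : IsUnit c := notMem_maximalIdeal.1 fun h => h1 (by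
    rw [← hc]
    exact Submodule.smul_mem_smul h trivial)
  exact ⟨hcu.unit, hc.symm⟩

end LineGenerators

/-! ### From isotropic frames of vectors to isotropic lines in coordinates -/

section IsotropicLines

open IsLocalRing

variable {R : Type*} [CommRing R]

/-- The splitting of the hyperbolic basis into its two halves. -/
def coordHalves (R : Type*) [CommRing R] (n : ℕ) :
    (Fin (2 * n) → R) →ₗ[R] (Fin n → R) × (Fin n → R) where
  toFun x := (oddCoord x, evenCoord x)
  map_add' _ _ := rfl
  map_smul' _ _ := rfl

theorem coordHalves_bijective (n : ℕ) : Function.Bijective (coordHalves R n) := by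
  constructor
  · intro x y hxy
    have h1 := congrArg Prod.fst hxy
    have h2 := congrArg Prod.snd hxy
    ext ⟨j, hj⟩
    rcases Nat.even_or_odd' j with ⟨i, rfl | rfl⟩
    · exact congrFun h1 ⟨i, by omega⟩
    · exact congrFun h2 ⟨i, by omega⟩
  · intro y
    refine ⟨fun j => if (j : ℕ) % 2 = 0 then y.1 ⟨j / 2, by omega⟩ else y.2 ⟨j / 2, by omega⟩, ?_⟩
    refine Prod.ext (funext fun i => ?_) (funext fun i => ?_)
    · change (if (2 * (i : ℕ)) % 2 = 0 then _ else _) = _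
      simp
    · have h1 : (2 * (i : ℕ) + 1) % 2 = 1 := by omega
      have h2 : (2 * (i : ℕ) + 1) / 2 = i := by omega
      change (if (2 * (i : ℕ) + 1) % 2 = 0 then _ else _) = _
      simp [h1, h2]

theorem coordHalves_mem_iff [IsLocalRing R] {n : ℕ} {x : Fin (2 * n) → R} :
    coordHalves R n x ∈ maximalIdeal R • (⊤ : Submodule R ((Fin n → R) × (Fin n → R))) ↔
      x ∈ maximalIdeal R • (⊤ : Submodule R (Fin (2 * n) → R)) := by
  refine ⟨fun h => ?_, LinearMap.apply_mem_maximalIdeal_smul_top _⟩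
  set e := LinearEquiv.ofBijective _ (coordHalves_bijective (R := R) n)
  have := LinearMap.apply_mem_maximalIdeal_smul_top e.symm.toLinearMap h
  have hx : e.symm (coordHalves R n x) = x := e.symm_apply_apply x
  simpa [hx] using this

variable [StarRing R] {ε : R} {Λ : AddSubgroup R}

theorem hypForm_eq_sesqForm {n : ℕ} (x y : Fin (2 * n) → R) :
    hypForm ε x y = sesqForm ε (coordHalves R n x) (coordHalves R n y) := by
  rw [sesqForm_apply]
  rfl

theorem hypQuad_eq_zero_iff {n : ℕ} (x : Fin (2 * n) → R) :
    hypQuad Λ x = 0 ↔ quadValue (coordHalves R n x) ∈ Λ :=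
  QuotientAddGroup.eq_zero_iff _

variable [IsLocalRing R]

theorem IsIsotropicFrame.map_of_unit_smul (hΛ : IsFormParameter ε Λ) {ι α : Type*} [Fintype ι]
    {l : List α} {f g : α → (ι → R) × (ι → R)} (h : ∀ a ∈ l, ∃ u : Rˣ, g a = (u : R) • f a)
    (hl : IsIsotropicFrame ε Λ (l.map f)) : IsIsotropicFrame ε Λ (l.map g) := by
  obtain ⟨h1, h2, h3⟩ := hl
  simp only [List.forall_mem_map] at h1 h2
  refine ⟨?_, ?_, h3.map_of_unit_smul h⟩ <;> simp only [List.forall_mem_map]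
  · intro a ha
    obtain ⟨u, hu⟩ := h a ha
    rw [hu]
    exact quadValue_smul_mem hΛ _ (h1 a ha)
  · intro a ha b hb
    obtain ⟨u, hu⟩ := h a ha
    obtain ⟨w, hw⟩ := h b hb
    rw [hu, hw, map_smul, sesqForm_smul_left, h2 a ha b hb, mul_zero, smul_zero]

/-- Isotropy of the whole span reduces to the generators: orthogonality by linearity in each slot,
and then `q` is additive modulo `Λ` on the span. -/
theorem mem_isotropicUnimodularPoset_iff (hε : ε * star ε = 1) (hΛ : IsFormParameter ε Λ) {n : ℕ}
    {v : List (Fin (2 * n) → R)} : v ∈ (isotropicUnimodularPoset ε Λ n).carrier ↔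
      v ≠ [] ∧ IsIsotropicFrame ε Λ (v.map (coordHalves R n)) := by
  have hind : ResidueIndependent R v ↔ ResidueIndependent R (v.map (coordHalves R n)) := by
    have := ResidueIndependent.append_iff_map (coordHalves R n) ⊤ (w := []) trivial (by simp)
      (fun x _ hx => Submodule.mem_sup_right (coordHalves_mem_iff.1 hx)) (l := v) (by simp)
    rwa [List.append_nil] at this
  constructor
  · rintro ⟨⟨hne, hv⟩, h1, h2⟩
    refine ⟨hne, ?_, ?_, hind.1 hv.residueIndependent⟩ <;> simp only [List.forall_mem_map]
    · exact fun x hx => (hypQuad_eq_zero_iff x).1 (h1 x (Submodule.subset_span hx))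
    · intro x hx y hy
      rw [← hypForm_eq_sesqForm]
      exact h2 x (Submodule.subset_span hx) y (Submodule.subset_span hy)
  · rintro ⟨hne, h1, h2, h3⟩
    simp only [List.forall_mem_map] at h1 h2
    have hright : ∀ x ∈ v, ∀ y ∈ Submodule.span R {z | z ∈ v},
        sesqForm ε (coordHalves R n x) (coordHalves R n y) = 0 := fun x hx y hy =>
      (Submodule.span_le.2 (h2 x hx) : Submodule.span R {z | z ∈ v} ≤
        LinearMap.ker (sesqForm ε (coordHalves R n x) ∘ₗ coordHalves R n)) hy
    have hboth : ∀ x ∈ Submodule.span R {z | z ∈ v}, ∀ y ∈ Submodule.span R {z | z ∈ v},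
        sesqForm ε (coordHalves R n x) (coordHalves R n y) = 0 := fun x hx y hy =>
      sesqForm_eq_zero_comm hε ((Submodule.span_le.2
        (fun z hz => sesqForm_eq_zero_comm hε (hright z hz y hy)) :
        Submodule.span R {z | z ∈ v} ≤
          LinearMap.ker (sesqForm ε (coordHalves R n y) ∘ₗ coordHalves R n)) hx)
    refine ⟨⟨hne, (hind.2 h3).isUnimodularSeq (Pi.basisFun R _)⟩, fun x hx => ?_,
      fun x hx y hy => by rw [hypForm_eq_sesqForm]; exact hboth x hx y hy⟩
    rw [hypQuad_eq_zero_iff]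
    change x ∈ Submodule.span R {z | z ∈ v} at hx
    induction hx using Submodule.span_induction with
    | mem x hx => exact h1 x hx
    | zero =>
      rw [map_zero]
      simp [quadValue, Λ.zero_mem]
    | add x y hx hy ihx ihy =>
      have := quadValue_add hΛ (coordHalves R n x) (coordHalves R n y)
      rw [hboth x hx y hy, sub_zero] at this
      have := Λ.add_mem (Λ.add_mem this ihy) ihx
      rw [map_add]
      convert this using 1
      ring
    | smul c x _ ihx =>
      rw [map_smul]
      exact quadValue_smul_mem hΛ c ihx

theorem mem_lineIU_iff (hε : ε * star ε = 1) (hΛ : IsFormParameter ε Λ) {n : ℕ}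
    {L : List (Submodule R (Fin (2 * n) → R))} : L ∈ (lineIU ε Λ n).carrier ↔
      L ≠ [] ∧ (∀ x ∈ L, ∃ v, v ∉ maximalIdeal R • (⊤ : Submodule R (Fin (2 * n) → R)) ∧
          x = Submodule.span R {v}) ∧
        IsIsotropicFrame ε Λ (L.map fun x => coordHalves R n (lineGenerator x)) := by
  constructor
  · rintro ⟨v, hv, rfl⟩
    obtain ⟨hne, hfr⟩ := (mem_isotropicUnimodularPoset_iff hε hΛ).1 hv
    have hmem : ∀ x ∈ v, x ∉ maximalIdeal R • (⊤ : Submodule R (Fin (2 * n) → R)) := fun x hx h =>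
      hfr.3.notMem (List.mem_map_of_mem hx) (coordHalves_mem_iff.2 h)
    refine ⟨by simpa using hne, ?_, ?_⟩
    · simp only [List.forall_mem_map]
      exact fun x hx => ⟨x, hmem x hx, rfl⟩
    · rw [List.map_map]
      refine hfr.map_of_unit_smul hΛ fun x hx => ?_
      obtain ⟨u, hu⟩ := exists_lineGenerator_eq_smul (hmem x hx)
      exact ⟨u, by rw [Function.comp_apply, hu, map_smul]⟩
  · rintro ⟨hne, hL, hfr⟩
    refine ⟨L.map lineGenerator, (mem_isotropicUnimodularPoset_iff hε hΛ).2
      ⟨by simpa using hne, by rw [List.map_map]; exact hfr⟩, ?_⟩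
    rw [List.map_map]
    refine L.map_id.symm.trans (List.map_congr_left fun x hx => ?_)
    exact (lineGenerator_spec (hL x hx)).2

/-- Here `S` consists of submodules, `A` of unimodular lines, and `π` chooses a generator; a chosen
generator agrees with a prescribed one only up to a unit, as the hypothesis on `π` allows. -/
theorem lineIU_isAcyclic [Infinite (ResidueField R)] (hε : ε * star ε = 1)
    (hΛ : IsFormParameter ε Λ) (n : ℕ) : (lineIU ε Λ n).IsAcyclic ((n : ℤ) - 2) := by
  refine FramePoset.isAcyclic_of_exactAt _ _ fun ℓ hℓ hℓ' => ?_
  convert exactAt_isIsotropicFrame hε hΛ n (Fin n)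
    {L : Submodule R (Fin (2 * n) → R) | ∃ v,
      v ∉ maximalIdeal R • (⊤ : Submodule R (Fin (2 * n) → R)) ∧ L = Submodule.span R {v}}
    (fun L => coordHalves R n (lineGenerator L)) (Fintype.card_fin n) ?_ ℓ (by omega) using 1
  · ext L
    rw [Set.mem_ofPred_eq, mem_lineIU_iff hε hΛ]
    rcases eq_or_ne L [] with rfl | hL
    · refine ⟨fun _ => ⟨by simp, by simp, by simp, trivial⟩, fun _ => Or.inl rfl⟩
    · simp only [hL, false_or, ne_eq, not_false_eq_true, true_and]
      rfl
  · intro y hy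
    obtain ⟨v, rfl⟩ := (coordHalves_bijective n).2 y
    have hv := fun h => hy (coordHalves_mem_iff.2 h)
    obtain ⟨u, hu⟩ := exists_lineGenerator_eq_smul hv
    exact ⟨Submodule.span R {v}, ⟨v, hv, rfl⟩, u, by rw [hu, map_smul]⟩

end IsotropicLines

theorem theorem2p7 {R : Type*} [CommRing R] [IsLocalRing R]
    [Infinite (IsLocalRing.ResidueField R)] [StarRing R]
    (ε : R) (hε : ε * star ε = 1) (Λ : AddSubgroup R) (hΛ : IsFormParameter ε Λ)
    (n m : ℕ) (hnm : n ≤ m) :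
    ((lineU R m).restrict (projSpaceIn R hnm)).IsAcyclic ((n : ℤ) - 2) ∧
    (∀ w ∈ (lineU R m).carrier,
      (((lineU R m).link w).restrict (projSpaceIn R hnm)).IsAcyclic
        ((n : ℤ) - (w.length : ℤ) - 2)) ∧
    (lineIU ε Λ n).IsAcyclic ((n : ℤ) - 2) := by
  refine ⟨?_, fun w _ => ?_, lineIU_isAcyclic hε hΛ n⟩
  · have h := isAcyclic_of_carrier_eq hnm [] ((lineU R m).restrict (projSpaceIn R hnm)) (by
      ext v
      simp only [List.append_nil, Set.mem_ofPred_eq]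
      exact ⟨fun h => ⟨((lineU R m).subset_ordSeq h.1).1, h⟩, fun h => h.2⟩)
    simpa using h
  · refine isAcyclic_of_carrier_eq hnm w _ ?_
    ext v
    constructor
    · rintro ⟨⟨h1, h2⟩, h3⟩
      exact ⟨((lineU R m).subset_ordSeq h1).1, h2, h3⟩
    · rintro ⟨h1, h2, h3⟩
      exact ⟨⟨(lineU R m).chain h2 (List.sublist_append_left v w) h1, h2⟩, h3⟩
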